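/- For a prime $p$, an integer $r\ge 1$ and rational numbers $x,y$, write $x\equiv y \pmod{p^r}$ if $x-y=p^r c$ for some rational number $c$ whose reduced denominator is not divisible by $p$. Let $H_{p-1}(1)=\sum_{k=1}^{p-1}\frac1k$, and let $B_m$ denote the Bernoulli numbers, defined by $\frac{t}{e^t-1}=\sum_{m\ge 0}B_m\frac{t^m}{m!}$. Then for every prime $p>5$, $$\sum_{k=1}^{p-1}\frac{21k-8}{k^3\binom{2k}{k}^3}+\frac{p-1}{p^3}\equiv\frac{H_{p-1}(1)}{p^2}\,(15p-6)+\frac{12}{5}\,p^2B_{p-5}\pmod{p^3}.$$ -/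

import Mathlib

/-- Congruence of rational numbers modulo a positive integer `m`: `x ≡ y (mod m)` means that
`x - y = m * c` for a rational number `c` whose reduced denominator is coprime to `m`.
For `m = p ^ r` with `p` prime this is `x - y ∈ p ^ r ℤ_(p)`. -/
def RatModEq (m : ℕ) (x y : ℚ) : Prop :=
  ∃ c : ℚ, Nat.Coprime c.den m ∧ x - y = (m : ℚ) * c

/-!
Write `v_k = C(p+k, k)⁻¹ = ∏_{m ≤ k} (1 + p/m)⁻¹`, `v = v_{p-1}` and `H^{(s)} = ∑_{k<p} 1/k^s`. A WZ
pair relates the partial sums of Zeilberger's series to those of `3 ∑ 1/(k² C(2k, k))`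
(`zeilberger_sum_eq`), and the latter have a closed error term (`apery_sum_eq`). Both error terms are
sums of inverse binomial coefficients, and telescoping extracts their poles at `p`. The outcome
(`zeilberger_sum_eq_invBinom`) is the exact identity
`S = H^{(2)} + (1-v)/p² + V + 3v/(2p²) + (1 - 5p/2) v³/p³ + vU/2`
for the sum `S` of the theorem, with `V = ∑_{k<p} v_k/k²` and `U = ∑_{k<p} v_k²/k²`.

It remains to expand `v` modulo `p⁶` and `U`, `V` modulo `p³`.
* Since `∏ (1 - p/m) = 1`, one has `1/v = ∏ (1 - p²/m²)`, whence
  `v ≡ 1 - 2p H_{p-1} + p⁴ H^{(4)}` (`invBinom_pred_sub_mem`), using the relations between the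
  `H^{(s)}` that come from `k ↦ p - k`.
* `V ≡ -H^{(2)}/2` and `U ≡ -2 H^{(2)}` (`sum_invBinom_div_sq_add_mem`,
  `sum_invBinom_sq_div_sq_add_mem`). The sums of `H_k/k²` and `H_k²/k²` that occur are found with the
  binomial transform `∑ (-1)^(k-1) C(n, k) x_k`: at `n = p - 1` it has an exact evaluation on powers
  of `1/k` and on star sums, and also a `p`-adic expansion, because
  `(-1)^k C(p-1, k) = ∏_{m ≤ k} (1 - p/m)`.
* The same comparison for `1/k⁴` gives `H^{(4)} ≡ (4/5) p ∑ H_k/k⁴` modulo `p²`, and Faulhaber's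
  formula evaluates the last sum as `B_{p-5}` modulo `p` (`powHarmonic_four_sub_bernoulli_mem`).

Congruences are expressed as membership in the balls `p^r ℤ_(p)` of `ℚ`, with `r` an integer.
-/

/-! ### Power sums and inverse binomial coefficients -/

/-- The power sum `∑_{k=1}^n 1/k^s`, with summation index `k - 1` in `Finset.range n`. -/
def powHarmonic (s n : ℕ) : ℚ := ∑ k ∈ Finset.range n, 1 / ((k : ℚ) + 1) ^ s

/-- The inverse binomial coefficient `1 / C(n+k, k) = ∏_{m=1}^k m/(m+n)`. -/
def invBinom (n k : ℕ) : ℚ := 1 / ((n + k).choose k : ℚ)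

theorem powHarmonic_succ (s n : ℕ) :
    powHarmonic s (n + 1) = powHarmonic s n + 1 / ((n : ℚ) + 1) ^ s :=
  Finset.sum_range_succ _ _

@[simp] theorem powHarmonic_zero (s : ℕ) : powHarmonic s 0 = 0 := by simp [powHarmonic]

@[simp] theorem invBinom_zero (n : ℕ) : invBinom n 0 = 1 := by simp [invBinom]

theorem invBinom_eq_factorial (n k : ℕ) :
    invBinom n k = (n.factorial * k.factorial : ℚ) / ((n + k).factorial : ℚ) := by
  have h := Nat.add_choose_mul_factorial_mul_factorial n k
  have hc : ((n + k).choose k : ℚ) ≠ 0 := by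
    have : 0 < (n + k).choose k := Nat.choose_pos (Nat.le_add_left k n)
    positivity
  have h' : ((n + k).choose k : ℚ) * n.factorial * k.factorial = (n + k).factorial := by
    exact_mod_cast h
  unfold invBinom
  rw [← h']
  have := Nat.factorial_ne_zero n
  have := Nat.factorial_ne_zero k
  field_simp

theorem invBinom_comm (n k : ℕ) : invBinom n k = invBinom k n := by
  rw [invBinom_eq_factorial, invBinom_eq_factorial, add_comm n k, mul_comm]

theorem invBinom_succ_right (n k : ℕ) :
    invBinom n (k + 1) = invBinom n k * ((k + 1) / (n + k + 1)) := by
  rw [invBinom_eq_factorial, invBinom_eq_factorial, ← add_assoc, Nat.factorial_succ,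
    Nat.factorial_succ (n + k)]
  have := Nat.factorial_ne_zero (n + k)
  have : (n : ℚ) + k + 1 ≠ 0 := by positivity
  push_cast
  field_simp

theorem invBinom_succ_left (n k : ℕ) :
    invBinom (n + 1) k = invBinom n k * ((n + 1) / (n + k + 1)) := by
  rw [invBinom_comm, invBinom_succ_right, invBinom_comm, add_comm (n : ℚ) k]

theorem invBinom_succ_succ_self (n : ℕ) :
    invBinom (n + 1) (n + 1) = invBinom n n * ((n + 1) / (2 * (2 * n + 1))) := by
  rw [invBinom_succ_right, invBinom_succ_left]
  have : (n : ℚ) + n + 1 ≠ 0 := by positivity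
  have : (n : ℚ) + 1 + n + 1 ≠ 0 := by positivity
  have : 2 * (n : ℚ) + 1 ≠ 0 := by positivity
  push_cast
  field_simp
  ring

/-! ### Exact evaluation of Zeilberger's sum -/

/-- The telescoping sum behind `apery_sum_eq`, from `C(n+k-1, k-1)⁻¹ - C(n+k, k)⁻¹ = (n/k) C(n+k, k)⁻¹`. -/
theorem sum_invBinom_div (n M : ℕ) :
    n * ∑ k ∈ Finset.range M, invBinom n (k + 1) / ((k : ℚ) + 1) = 1 - invBinom n M := by
  induction M with
  | zero => simp
  | succ M ih =>
    rw [Finset.sum_range_succ, mul_add, ih, invBinom_succ_right]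
    have : (n : ℚ) + M + 1 ≠ 0 := by positivity
    have : (M : ℚ) + 1 ≠ 0 := by positivity
    field_simp
    ring

/-- The finite form of `3 ∑ 1/(k² C(2k, k)) = ζ(2)`: the error term after `n` terms is
`∑_{k ≤ n} 1/(k² C(n+k, k))`. -/
theorem apery_sum_eq (n : ℕ) :
    3 * ∑ k ∈ Finset.range n, invBinom (k + 1) (k + 1) / ((k : ℚ) + 1) ^ 2 =
      powHarmonic 2 n + ∑ k ∈ Finset.range n, invBinom n (k + 1) / ((k : ℚ) + 1) ^ 2 := by
  induction n with
  | zero => simp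
  | succ n ih =>
    have hn : (n : ℚ) + 1 ≠ 0 := by positivity
    have key : ∑ k ∈ Finset.range n, invBinom (n + 1) (k + 1) / ((k : ℚ) + 1) ^ 2 =
        ∑ k ∈ Finset.range n, invBinom n (k + 1) / ((k : ℚ) + 1) ^ 2 -
          1 / (n + 1) * ∑ k ∈ Finset.range n, invBinom (n + 1) (k + 1) / ((k : ℚ) + 1) := by
      rw [Finset.mul_sum, ← Finset.sum_sub_distrib]
      refine Finset.sum_congr rfl fun k _ => ?_
      rw [invBinom_succ_left]
      have : (n : ℚ) + k + 1 + 1 ≠ 0 := by positivity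
      have : (k : ℚ) + 1 ≠ 0 := by positivity
      push_cast
      field_simp
      ring
    have h2 := sum_invBinom_div (n + 1) n
    have h3 : ∑ k ∈ Finset.range n, invBinom (n + 1) (k + 1) / ((k : ℚ) + 1) =
        (1 - invBinom (n + 1) n) / (n + 1) := by
      push_cast at h2
      rw [eq_div_iff hn, ← h2]; ring
    have h4 : invBinom (n + 1) n = 2 * invBinom (n + 1) (n + 1) := by
      rw [invBinom_succ_right]
      have : (n : ℚ) + 1 + n + 1 ≠ 0 := by positivity
      push_cast
      field_simp
      ring
    rw [Finset.sum_range_succ, mul_add, ih, powHarmonic_succ, Finset.sum_range_succ, key, h3, h4]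
    field_simp
    ring

/-- Zeilberger's sum and the sum `3 ∑ 1/(k² C(2k, k))` come from the same WZ pair, summed along a
coordinate direction and along a diagonal. With
`F(n, j) = C(2n, n)⁻¹ C(n+j, j)⁻² (n+1+j)⁻²` and `G = F · (2j + 3(n+1)) / (2(2n+1))` one has
`F(n+1, j) - F(n, j) = G(n, j+1) - G(n, j)`. -/
theorem zeilberger_sum_eq (n : ℕ) :
    ∑ k ∈ Finset.range n,
        (21 * ((k : ℚ) + 1) - 8) * invBinom (k + 1) (k + 1) ^ 3 / ((k : ℚ) + 1) ^ 3 =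
      3 * ∑ k ∈ Finset.range n, invBinom (k + 1) (k + 1) / ((k : ℚ) + 1) ^ 2 +
        invBinom n n * ∑ j ∈ Finset.range n, invBinom n j ^ 2 / ((n : ℚ) + 1 + j) ^ 2 := by
  induction n with
  | zero => simp
  | succ n ih =>
    have hn : (n : ℚ) + 1 ≠ 0 := by positivity
    have hn2 : 2 * (n : ℚ) + 1 ≠ 0 := by positivity
    have tel : ∀ M : ℕ,
        invBinom (n + 1) (n + 1) *
            ∑ j ∈ Finset.range M, invBinom (n + 1) j ^ 2 / ((n : ℚ) + 1 + 1 + j) ^ 2 -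
          invBinom n n * ∑ j ∈ Finset.range M, invBinom n j ^ 2 / ((n : ℚ) + 1 + j) ^ 2 =
        invBinom n n * (invBinom n M ^ 2 / ((n : ℚ) + 1 + M) ^ 2 *
            ((2 * M + 3 * (n + 1)) / (2 * (2 * n + 1))) -
          3 / (2 * (n + 1) * (2 * n + 1))) := by
      intro M
      induction M with
      | zero =>
        simp only [Finset.range_zero, Finset.sum_empty, invBinom_zero, Nat.cast_zero]
        field_simp
        ring
      | succ M ihM =>
        rw [Finset.sum_range_succ, Finset.sum_range_succ, mul_add, mul_add,
          add_sub_add_comm, ihM, invBinom_succ_succ_self, invBinom_succ_left, invBinom_succ_right]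
        have : (n : ℚ) + M + 1 ≠ 0 := by positivity
        have : (n : ℚ) + 1 + M ≠ 0 := by positivity
        have : (n : ℚ) + 1 + 1 + M ≠ 0 := by positivity
        have : (n : ℚ) + 1 + (M + 1) ≠ 0 := by positivity
        push_cast
        field_simp
        ring
    have t := tel n
    rw [sub_eq_iff_eq_add] at t
    rw [Finset.sum_range_succ, ih, Finset.sum_range_succ, Finset.sum_range_succ]
    push_cast
    rw [mul_add (invBinom (n + 1) (n + 1)), t, invBinom_succ_succ_self, invBinom_succ_left]
    have : (n : ℚ) + n + 1 ≠ 0 := by positivity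
    have : (n : ℚ) + 1 + n ≠ 0 := by positivity
    have : (n : ℚ) + 1 + 1 + n ≠ 0 := by positivity
    field_simp
    ring

/-- A partial summation that trades `∑ C(n+k, k)⁻²` for `n³ ∑ C(n+k, k)⁻²/k²`. For `n = p` the factor
`p³` compensates the denominator of the WZ term, so that only a low `p`-adic precision of the new
sum is needed. -/
theorem sum_invBinom_sq (n M : ℕ) :
    (1 - 2 * (n : ℚ)) * ∑ k ∈ Finset.range M, invBinom n (k + 1) ^ 2 =
      (M + 1 - n / 2) * invBinom n M ^ 2 - (1 - n / 2) -
        n ^ 3 / 2 * ∑ k ∈ Finset.range M, invBinom n (k + 1) ^ 2 / ((k : ℚ) + 1) ^ 2 := by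
  induction M with
  | zero => simp
  | succ M ih =>
    rw [Finset.sum_range_succ, mul_add, ih, Finset.sum_range_succ, invBinom_succ_right]
    have : (n : ℚ) + M + 1 ≠ 0 := by positivity
    have : (M : ℚ) + 1 ≠ 0 := by positivity
    push_cast
    field_simp
    ring

/-- Zeilberger's sum up to `n = p - 1` in terms of `C(p+k, k)⁻¹`, which is a `p`-adic unit for `k < p`:
the negative powers of `p` are now explicit. -/
theorem zeilberger_sum_eq_invBinom (n : ℕ) :
    ∑ k ∈ Finset.range n,
        (21 * ((k : ℚ) + 1) - 8) * invBinom (k + 1) (k + 1) ^ 3 / ((k : ℚ) + 1) ^ 3 =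
      powHarmonic 2 n + (1 - invBinom (n + 1) n) / ((n : ℚ) + 1) ^ 2 +
        ∑ k ∈ Finset.range n, invBinom (n + 1) (k + 1) / ((k : ℚ) + 1) ^ 2 +
        3 * invBinom (n + 1) n / (2 * ((n : ℚ) + 1) ^ 2) +
        (1 - 5 * ((n : ℚ) + 1) / 2) * invBinom (n + 1) n ^ 3 / ((n : ℚ) + 1) ^ 3 +
        invBinom (n + 1) n / 2 *
          ∑ k ∈ Finset.range n, invBinom (n + 1) (k + 1) ^ 2 / ((k : ℚ) + 1) ^ 2 := by
  have hn : (n : ℚ) + 1 ≠ 0 := by positivity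
  have h1 : ∑ k ∈ Finset.range n, invBinom n (k + 1) / ((k : ℚ) + 1) ^ 2 =
      (1 - invBinom (n + 1) n) / ((n : ℚ) + 1) ^ 2 +
        ∑ k ∈ Finset.range n, invBinom (n + 1) (k + 1) / ((k : ℚ) + 1) ^ 2 := by
    rw [← sum_invBinom_div, Finset.mul_sum, Finset.sum_div, ← Finset.sum_add_distrib]
    refine Finset.sum_congr rfl fun k _ => ?_
    rw [invBinom_succ_left]
    have : (n : ℚ) + k + 1 + 1 ≠ 0 := by positivity
    have : (n : ℚ) + (k + 1) + 1 ≠ 0 := by positivity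
    have : (k : ℚ) + 1 ≠ 0 := by positivity
    push_cast
    field_simp
    ring
  have h2 : ∑ j ∈ Finset.range n, invBinom n j ^ 2 / ((n : ℚ) + 1 + j) ^ 2 =
      (1 + ∑ k ∈ Finset.range n, invBinom (n + 1) (k + 1) ^ 2 - invBinom (n + 1) n ^ 2) /
        ((n : ℚ) + 1) ^ 2 := by
    have h := Finset.sum_range_succ' (fun k => invBinom (n + 1) k ^ 2) n
    rw [Finset.sum_range_succ] at h
    rw [eq_div_iff (by positivity)]
    trans ∑ k ∈ Finset.range n, invBinom (n + 1) k ^ 2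
    · rw [Finset.sum_mul]
      refine Finset.sum_congr rfl fun k _ => ?_
      rw [invBinom_succ_left]
      have : (n : ℚ) + k + 1 ≠ 0 := by positivity
      have : (n : ℚ) + 1 + k ≠ 0 := by positivity
      field_simp
      ring
    · simp only [invBinom_zero] at h
      linarith
  have h3 : invBinom n n = invBinom (n + 1) n * (2 * ((n : ℚ) + 1) - 1) / (n + 1) := by
    rw [invBinom_succ_left]
    have : (n : ℚ) + n + 1 ≠ 0 := by positivity
    field_simp
    ring
  have h4 := sum_invBinom_sq (n + 1) n
  rw [zeilberger_sum_eq, apery_sum_eq, h1, h2, h3]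
  push_cast at h4
  generalize ∑ k ∈ Finset.range n, invBinom (n + 1) (k + 1) ^ 2 = Q at *
  generalize ∑ k ∈ Finset.range n, invBinom (n + 1) (k + 1) ^ 2 / ((k : ℚ) + 1) ^ 2 = U at *
  generalize ∑ k ∈ Finset.range n, invBinom (n + 1) (k + 1) / ((k : ℚ) + 1) ^ 2 = V at *
  generalize invBinom (n + 1) n = v at *
  generalize (n : ℚ) + 1 = q at *
  field_simp
  linear_combination (-2 * v) * h4

/-! ### The binomial transform and complete homogeneous harmonic sums -/

/-- The alternating binomial transform `n ↦ ∑_{k=1}^n (-1)^(k-1) C(n, k) x_k` of a sequence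
`x_1, x_2, …`, where `x_k` is encoded as `x (k - 1)`. -/
def binomTransform (x : ℕ → ℚ) (n : ℕ) : ℚ :=
  ∑ k ∈ Finset.range n, (-1) ^ k * (n.choose (k + 1) : ℚ) * x k

theorem binomTransform_div (x : ℕ → ℚ) (n : ℕ) :
    binomTransform (fun k => x k / (k + 1)) n =
      ∑ m ∈ Finset.range n, binomTransform x (m + 1) / ((m : ℚ) + 1) := by
  induction n with
  | zero => simp [binomTransform]
  | succ n ih =>
    rw [Finset.sum_range_succ, ← ih]
    have h : ∑ k ∈ Finset.range (n + 1), (-1) ^ k * (n.choose (k + 1) : ℚ) * (x k / (k + 1)) =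
        binomTransform (fun k => x k / (k + 1)) n := by
      rw [Finset.sum_range_succ, Nat.choose_succ_self]
      simp [binomTransform]
    rw [← h]
    unfold binomTransform
    rw [Finset.sum_div, ← Finset.sum_add_distrib]
    refine Finset.sum_congr rfl fun k _ => ?_
    have h1 : ((n + 1).choose (k + 1) : ℚ) = n.choose k + n.choose (k + 1) := by
      exact_mod_cast Nat.choose_succ_succ n k
    have h2 : ((n : ℚ) + 1) * n.choose k = (n + 1).choose (k + 1) * (k + 1) := by
      exact_mod_cast Nat.add_one_mul_choose_eq n k
    have : (k : ℚ) + 1 ≠ 0 := by positivity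
    have : (n : ℚ) + 1 ≠ 0 := by positivity
    field_simp
    linear_combination x k * (n + 1) * h1 + x k * h2

/-- The inverse rule to `binomTransform_div`; the proof is summation by parts with
`∑_{k ≥ l} (-1)^(k-1) C(n, k) = (-1)^(l-1) C(n-1, l-1)`. -/
theorem binomTransform_sum (x : ℕ → ℚ) (n : ℕ) :
    binomTransform (fun k => ∑ l ∈ Finset.range (k + 1), x l / ((l : ℚ) + 1)) (n + 1) =
      binomTransform x (n + 1) / (n + 1) := by
  have key : ∀ M : ℕ, ∑ k ∈ Finset.range M, (-1) ^ k * ((n + 1).choose (k + 1) : ℚ) *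
        ∑ l ∈ Finset.range (k + 1), x l / ((l : ℚ) + 1) =
      ∑ l ∈ Finset.range M, (-1) ^ l * (n.choose l : ℚ) * (x l / ((l : ℚ) + 1)) -
        (-1) ^ M * n.choose M * ∑ l ∈ Finset.range M, x l / ((l : ℚ) + 1) := by
    intro M
    induction M with
    | zero => simp
    | succ M ih =>
      rw [Finset.sum_range_succ, ih, Finset.sum_range_succ _ M, Finset.sum_range_succ _ M,
        Nat.choose_succ_succ]
      push_cast
      ring
  unfold binomTransform
  rw [key, Nat.choose_succ_self, Finset.sum_div]
  simp only [Nat.cast_zero, mul_zero, zero_mul, sub_zero]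
  refine Finset.sum_congr rfl fun k _ => ?_
  have h2 : ((n : ℚ) + 1) * n.choose k = (n + 1).choose (k + 1) * (k + 1) := by
    exact_mod_cast Nat.add_one_mul_choose_eq n k
  have : (k : ℚ) + 1 ≠ 0 := by positivity
  have : (n : ℚ) + 1 ≠ 0 := by positivity
  field_simp
  linear_combination x k * h2

theorem binomTransform_one (n : ℕ) : binomTransform (fun _ => 1) (n + 1) = 1 := by
  have key : ∀ M : ℕ, ∑ k ∈ Finset.range M, (-1) ^ k * ((n + 1).choose (k + 1) : ℚ) * 1 =
      1 - (-1) ^ M * n.choose M := by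
    intro M
    induction M with
    | zero => simp
    | succ M ih =>
      rw [Finset.sum_range_succ, ih, Nat.choose_succ_succ]
      push_cast
      ring
  unfold binomTransform
  rw [key, Nat.choose_succ_self]
  simp

/-- The complete homogeneous symmetric sum
`∑_{n ≥ m₁ ≥ ⋯ ≥ m_r ≥ 1} 1/(m₁ ⋯ m_r)` of degree `r` in `1, 1/2, …, 1/n`. -/
def starHarmonic : ℕ → ℕ → ℚ
  | 0, _ => 1
  | r + 1, n => ∑ m ∈ Finset.range n, starHarmonic r (m + 1) / ((m : ℚ) + 1)

theorem starHarmonic_succ_succ (r n : ℕ) :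
    starHarmonic (r + 1) (n + 1) =
      starHarmonic (r + 1) n + starHarmonic r (n + 1) / ((n : ℚ) + 1) := by
  rw [starHarmonic, starHarmonic, Finset.sum_range_succ]

theorem starHarmonic_succ_zero (r : ℕ) : starHarmonic (r + 1) 0 = 0 := by
  simp [starHarmonic]

theorem binomTransform_one_div_pow (r n : ℕ) :
    binomTransform (fun k => 1 / ((k : ℚ) + 1) ^ r) (n + 1) = starHarmonic r (n + 1) := by
  induction r generalizing n with
  | zero => simpa [starHarmonic] using binomTransform_one n
  | succ r ih =>
    have := binomTransform_div (fun k => 1 / ((k : ℚ) + 1) ^ r) (n + 1)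
    simp only [ih, div_div, ← pow_succ] at this
    rw [this, starHarmonic]

/-- The transform is an involution: this is the inverse of `binomTransform_one_div_pow`. -/
theorem binomTransform_starHarmonic (r n : ℕ) :
    binomTransform (fun k => starHarmonic r (k + 1)) (n + 1) = 1 / ((n : ℚ) + 1) ^ r := by
  induction r with
  | zero => simpa [starHarmonic] using binomTransform_one n
  | succ r ih =>
    simp only [starHarmonic]
    rw [binomTransform_sum (fun l => starHarmonic r (l + 1)), ih, div_div, ← pow_succ]

theorem binomTransform_starHarmonic_div_sq (r n : ℕ) :
    binomTransform (fun k => starHarmonic r (k + 1) / ((k : ℚ) + 1) ^ 2) n =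
      ∑ m ∈ Finset.range n, powHarmonic (r + 1) (m + 1) / ((m : ℚ) + 1) := by
  have h1 : ∀ n, binomTransform (fun k => starHarmonic r (k + 1) / ((k : ℚ) + 1)) n =
      powHarmonic (r + 1) n := by
    intro n
    rw [binomTransform_div (fun k => starHarmonic r (k + 1))]
    simp only [binomTransform_starHarmonic, div_div, ← pow_succ, powHarmonic]
  have h2 := binomTransform_div (fun k => starHarmonic r (k + 1) / ((k : ℚ) + 1)) n
  simpa only [h1, div_div, ← sq] using h2

theorem starHarmonic_one (n : ℕ) : starHarmonic 1 n = powHarmonic 1 n := by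
  simp [starHarmonic, powHarmonic]

theorem starHarmonic_two (n : ℕ) :
    starHarmonic 2 n = (powHarmonic 1 n ^ 2 + powHarmonic 2 n) / 2 := by
  induction n with
  | zero => simp [starHarmonic_succ_zero]
  | succ n ih =>
    rw [starHarmonic_succ_succ, ih, starHarmonic_one]
    simp only [powHarmonic_succ]
    have : (n : ℚ) + 1 ≠ 0 := by positivity
    field_simp
    ring

theorem starHarmonic_three (n : ℕ) :
    starHarmonic 3 n =
      (powHarmonic 1 n ^ 3 + 3 * powHarmonic 1 n * powHarmonic 2 n + 2 * powHarmonic 3 n) / 6 := by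
  induction n with
  | zero => simp [starHarmonic_succ_zero]
  | succ n ih =>
    rw [starHarmonic_succ_succ, ih, starHarmonic_two]
    simp only [powHarmonic_succ]
    have : (n : ℚ) + 1 ≠ 0 := by positivity
    field_simp
    ring

theorem starHarmonic_four (n : ℕ) :
    starHarmonic 4 n =
      (powHarmonic 1 n ^ 4 + 6 * powHarmonic 1 n ^ 2 * powHarmonic 2 n + 3 * powHarmonic 2 n ^ 2 +
        8 * powHarmonic 1 n * powHarmonic 3 n + 6 * powHarmonic 4 n) / 24 := by
  induction n with
  | zero => simp [starHarmonic_succ_zero]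
  | succ n ih =>
    rw [starHarmonic_succ_succ, ih, starHarmonic_three]
    simp only [powHarmonic_succ]
    have : (n : ℚ) + 1 ≠ 0 := by positivity
    field_simp
    ring

theorem sum_powHarmonic_two_div_sq (n : ℕ) :
    ∑ k ∈ Finset.range n, powHarmonic 2 (k + 1) / ((k : ℚ) + 1) ^ 2 =
      (powHarmonic 2 n ^ 2 + powHarmonic 4 n) / 2 := by
  induction n with
  | zero => simp
  | succ n ih =>
    rw [Finset.sum_range_succ, ih]
    simp only [powHarmonic_succ]
    have : (n : ℚ) + 1 ≠ 0 := by positivity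
    field_simp
    ring

/-! ### `p`-adic balls in `ℚ` -/

/-- The additive subgroup `p^r ℤ_(p)` of `ℚ`, given as a ball for the `p`-adic norm. The exponent
is an integer, so that division by powers of `p` needs no side conditions. -/
def padicBall (p : ℕ) [Fact p.Prime] (r : ℤ) : AddSubgroup ℚ where
  carrier := {x | padicNorm p x ≤ (p : ℚ) ^ (-r)}
  zero_mem' := by simp only [Set.mem_ofPred_eq, padicNorm.zero]; positivity
  add_mem' := fun hx hy => padicNorm.nonarchimedean.trans (max_le hx hy)
  neg_mem' := fun {x} hx => by
    rw [Set.mem_ofPred_eq, padicNorm.neg]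
    exact hx

theorem cast_sub_one_sub {p k : ℕ} (hk : k < p - 1) :
    ((p - 1 - 1 - k : ℕ) : ℚ) + 1 = p - (k + 1) := by
  have : p - 1 - 1 - k + 1 + (k + 1) = p := by omega
  have h : (((p - 1 - 1 - k + 1 + (k + 1) : ℕ)) : ℚ) = p := by rw [this]
  push_cast at h ⊢
  linarith

theorem powHarmonic_reflect (p s : ℕ) :
    powHarmonic s (p - 1) = ∑ k ∈ Finset.range (p - 1), 1 / ((p : ℚ) - (k + 1)) ^ s := by
  rw [powHarmonic, ← Finset.sum_range_reflect]
  exact Finset.sum_congr rfl fun k hk => by rw [cast_sub_one_sub (Finset.mem_range.1 hk)]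

section padicBall

variable {p : ℕ} [Fact p.Prime]

theorem mem_padicBall {r : ℤ} {x : ℚ} : x ∈ padicBall p r ↔ padicNorm p x ≤ (p : ℚ) ^ (-r) :=
  Iff.rfl

theorem padicBall_anti {r s : ℤ} (h : r ≤ s) {x : ℚ} (hx : x ∈ padicBall p s) :
    x ∈ padicBall p r := by
  have hp : (1 : ℚ) ≤ p := by exact_mod_cast (Fact.out : p.Prime).one_le
  exact (mem_padicBall.1 hx).trans (zpow_le_zpow_right₀ hp (neg_le_neg h))

theorem mul_mem_padicBall {r s t : ℤ} {x y : ℚ} (hx : x ∈ padicBall p r) (hy : y ∈ padicBall p s)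
    (h : t ≤ r + s) : x * y ∈ padicBall p t := by
  refine padicBall_anti h ?_
  have hp : (p : ℚ) ≠ 0 := by exact_mod_cast (Fact.out : p.Prime).ne_zero
  rw [mem_padicBall] at *
  rw [padicNorm.mul, neg_add, zpow_add₀ hp]
  exact mul_le_mul hx hy (padicNorm.nonneg _) (by positivity)

theorem natCast_mem_padicBall (m : ℕ) : (m : ℚ) ∈ padicBall p 0 := by
  simpa [mem_padicBall] using padicNorm.of_nat (p := p) m

theorem one_mem_padicBall : (1 : ℚ) ∈ padicBall p 0 := by
  simpa using natCast_mem_padicBall (p := p) 1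

theorem prime_pow_mem_padicBall (k : ℕ) : (p : ℚ) ^ k ∈ padicBall p k := by
  have hp : (1 : ℕ) < p := (Fact.out : p.Prime).one_lt
  have h := (padicNorm.dvd_iff_norm_le (p := p) (n := k) (z := (p : ℤ) ^ k)).1 (by simp)
  rw [mem_padicBall]
  simpa using h

theorem prime_mem_padicBall : (p : ℚ) ∈ padicBall p 1 := by
  simpa using prime_pow_mem_padicBall (p := p) 1

theorem pow_mem_padicBall {x : ℚ} (hx : x ∈ padicBall p 0) (k : ℕ) : x ^ k ∈ padicBall p 0 := by
  induction k with
  | zero => simpa using one_mem_padicBall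
  | succ k ih => exact pow_succ x k ▸ mul_mem_padicBall ih hx (by norm_num)

theorem div_prime_pow_mem_padicBall {r : ℤ} {x : ℚ} (hx : x ∈ padicBall p r) (k : ℕ) {t : ℤ}
    (h : t + k ≤ r) : x / (p : ℚ) ^ k ∈ padicBall p t := by
  have hp : (p : ℚ) ≠ 0 := by exact_mod_cast (Fact.out : p.Prime).ne_zero
  have hk : 1 / (p : ℚ) ^ k ∈ padicBall p (-k) := by
    have hnorm : padicNorm p ((p : ℚ) ^ k) = (p : ℚ) ^ (-(k : ℤ)) := by
      rw [padicNorm.eq_zpow_of_nonzero (pow_ne_zero k hp), padicValRat.pow,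
        padicValRat.self (Fact.out : p.Prime).one_lt, mul_one]
    rw [mem_padicBall, padicNorm.div, hnorm]
    simp
  rw [div_eq_mul_one_div]
  exact mul_mem_padicBall hx hk (by linarith)

theorem one_div_natCast_mem_padicBall {m : ℕ} (hm : ¬ p ∣ m) : 1 / (m : ℚ) ∈ padicBall p 0 := by
  rw [mem_padicBall, padicNorm.div, (padicNorm.nat_eq_one_iff m).2 hm]
  simp

theorem one_div_natCast_mem_padicBall_of_lt {m : ℕ} (hm : 0 < m) (h : m < p) :
    1 / (m : ℚ) ∈ padicBall p 0 :=
  one_div_natCast_mem_padicBall (Nat.not_dvd_of_pos_of_lt hm h)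

theorem div_natCast_mem_padicBall {r : ℤ} {x : ℚ} (hx : x ∈ padicBall p r) {m : ℕ} (hm : 0 < m)
    (h : m < p) : x / (m : ℚ) ∈ padicBall p r := by
  rw [div_eq_mul_one_div]
  exact mul_mem_padicBall hx (one_div_natCast_mem_padicBall_of_lt hm h) (by simp)

theorem natCast_mul_mem_padicBall {r : ℤ} {x : ℚ} (m : ℕ) (hx : x ∈ padicBall p r) :
    (m : ℚ) * x ∈ padicBall p r :=
  mul_mem_padicBall (natCast_mem_padicBall m) hx (by simp)

theorem prime_pow_mul_mem_padicBall {r t : ℤ} {x : ℚ} (k : ℕ) (hx : x ∈ padicBall p r)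
    (h : t ≤ k + r) : (p : ℚ) ^ k * x ∈ padicBall p t :=
  mul_mem_padicBall (prime_pow_mem_padicBall k) hx h

theorem one_div_succ_pow_mem_padicBall {k : ℕ} (h : k + 1 < p) (s : ℕ) :
    1 / ((k : ℚ) + 1) ^ s ∈ padicBall p 0 := by
  have := pow_mem_padicBall (one_div_natCast_mem_padicBall_of_lt k.succ_pos h) s
  simpa using this

theorem powHarmonic_mem_padicBall {n : ℕ} (h : n < p) (s : ℕ) :
    powHarmonic s n ∈ padicBall p 0 :=
  AddSubgroup.sum_mem _ fun k hk =>
    one_div_succ_pow_mem_padicBall (by have := Finset.mem_range.1 hk; omega) s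

theorem ratModEq_of_mem_padicBall {r : ℕ} {x y : ℚ} (h : x - y ∈ padicBall p r) :
    RatModEq (p ^ r) x y := by
  have hp : (p : ℚ) ≠ 0 := by exact_mod_cast (Fact.out : p.Prime).ne_zero
  refine ⟨(x - y) / (p : ℚ) ^ r, ?_, by push_cast; field_simp⟩
  have hc : padicNorm p ((x - y) / (p : ℚ) ^ r) ≤ 1 := by
    simpa [mem_padicBall] using div_prime_pow_mem_padicBall h r (t := 0) (by simp)
  generalize (x - y) / (p : ℚ) ^ r = c at hc
  refine Nat.Coprime.pow_right _ (((Fact.out : p.Prime).coprime_iff_not_dvd.2 ?_).symm)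
  intro hd
  have hnum : ¬ p ∣ c.num.natAbs := fun hn =>
    (Fact.out : p.Prime).one_lt.ne' (Nat.dvd_one.1 (c.reduced ▸ Nat.dvd_gcd hn hd))
  have h1 : padicNorm p (c.num : ℚ) = 1 :=
    (padicNorm.int_eq_one_iff c.num).2 fun h => hnum (Int.natCast_dvd.1 h)
  have h2 : padicNorm p (c.den : ℚ) < 1 := (padicNorm.nat_lt_one_iff c.den).2 hd
  have h3 : c * c.den = c.num := Rat.mul_den_eq_num c
  have h4 := congrArg (padicNorm p) h3
  rw [padicNorm.mul, h1] at h4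
  have := padicNorm.nonneg (p := p) (c.den : ℚ)
  nlinarith

/-- Expansion of `∏ (1 + x a_k)` to second order in `x`, with the elementary symmetric sum of
degree two written in terms of power sums. -/
theorem prod_one_add_mul_sub_mem_padicBall (hp2 : 2 < p) {s : ℕ} {x : ℚ} (hx : x ∈ padicBall p s)
    (a : ℕ → ℚ) (M : ℕ) (ha : ∀ k < M, a k ∈ padicBall p 0) :
    ∏ k ∈ Finset.range M, (1 + x * a k) -
      (1 + x * ∑ k ∈ Finset.range M, a k +
        x ^ 2 * ((∑ k ∈ Finset.range M, a k) ^ 2 - ∑ k ∈ Finset.range M, a k ^ 2) / 2) ∈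
      padicBall p (3 * s) := by
  induction M with
  | zero => simp
  | succ M ih =>
    have hM := ih fun k hk => ha k (by omega)
    have hsum : ∑ k ∈ Finset.range M, a k ∈ padicBall p 0 :=
      AddSubgroup.sum_mem _ fun k hk => ha k (by have := Finset.mem_range.1 hk; omega)
    have hsum2 : ∑ k ∈ Finset.range M, a k ^ 2 ∈ padicBall p 0 :=
      AddSubgroup.sum_mem _ fun k hk =>
        pow_mem_padicBall (ha k (by have := Finset.mem_range.1 hk; omega)) 2
    have haM := ha M (by omega)
    rw [Finset.prod_range_succ, Finset.sum_range_succ, Finset.sum_range_succ]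
    generalize ∏ k ∈ Finset.range M, (1 + x * a k) = P at *
    generalize ∑ k ∈ Finset.range M, a k = A at *
    generalize ∑ k ∈ Finset.range M, a k ^ 2 = A2 at *
    have h1 : (A ^ 2 - A2) / (2 : ℕ) ∈ padicBall p 0 :=
      div_natCast_mem_padicBall (AddSubgroup.sub_mem _ (pow_mem_padicBall hsum 2) hsum2)
        (by norm_num) hp2
    have hx0 : x ∈ padicBall p 0 := padicBall_anti (by positivity) hx
    have h2 : 1 + x * a M ∈ padicBall p 0 :=
      AddSubgroup.add_mem _ one_mem_padicBall (mul_mem_padicBall hx0 haM (by simp))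
    have hx3 : x * (x * x) ∈ padicBall p (3 * s) :=
      mul_mem_padicBall hx (mul_mem_padicBall hx hx le_rfl) (by linarith)
    have h3 := mul_mem_padicBall hM h2 (t := 3 * s) (by simp)
    have h4 := mul_mem_padicBall hx3 (mul_mem_padicBall haM h1 (t := 0) (by simp)) (t := 3 * s)
      (by simp)
    convert AddSubgroup.add_mem _ h3 h4 using 1
    push_cast
    ring

/-! ### Bernoulli numbers and power sums modulo powers of `p` -/

/-- The Bernoulli numbers `B_i` with `i < p - 1` are `p`-integral, by the recursion, whose denominators
are at most `i + 1`. -/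
theorem bernoulli_mem_padicBall {i : ℕ} (hi : i + 1 < p) : bernoulli i ∈ padicBall p 0 := by
  have h : ∀ i : ℕ, i + 1 < p → bernoulli' i ∈ padicBall p 0 := by
    intro i
    induction i using Nat.strong_induction_on with
    | _ i ih =>
      intro hi
      rw [bernoulli'_def]
      refine AddSubgroup.sub_mem _ one_mem_padicBall (AddSubgroup.sum_mem _ fun k hk => ?_)
      have hk' := Finset.mem_range.1 hk
      refine mul_mem_padicBall (r := 0) (s := 0) ?_ (ih k hk' (by omega)) (by simp)
      have := div_natCast_mem_padicBall (natCast_mem_padicBall (p := p) (i.choose k))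
        (m := i - k + 1) (by omega) (by omega)
      rw [Nat.cast_add, Nat.cast_sub hk'.le, Nat.cast_one] at this
      exact this
  rcases neg_one_pow_eq_or ℚ i with h1 | h1
  · rw [bernoulli, h1, one_mul]; exact h i hi
  · rw [bernoulli, h1, neg_one_mul]; exact AddSubgroup.neg_mem _ (h i hi)

/-- Power sums with exponent `0 < e < p - 1` vanish modulo `p`: in Faulhaber's formula every term is
`p`-integral times a positive power of `p`. -/
theorem sum_range_pow_mem_padicBall {e : ℕ} (he0 : 0 < e) (he : e + 1 < p) :
    ∑ k ∈ Finset.range (p - 1), ((k : ℚ) + 1) ^ e ∈ padicBall p 1 := by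
  have h : ∑ k ∈ Finset.range (p - 1), ((k : ℚ) + 1) ^ e = ∑ k ∈ Finset.range p, (k : ℚ) ^ e := by
    obtain ⟨n, rfl⟩ : ∃ n, p = n + 1 := ⟨p - 1, by omega⟩
    rw [Finset.sum_range_succ']
    simp [he0.ne']
  rw [h, sum_range_pow]
  refine AddSubgroup.sum_mem _ fun i hi => ?_
  have hi' := Finset.mem_range.1 hi
  have h1 := mul_mem_padicBall (bernoulli_mem_padicBall (p := p) (i := i) (by omega))
    (natCast_mem_padicBall ((e + 1).choose i)) (t := 0) (by simp)
  have h2 := mul_mem_padicBall h1 (prime_pow_mem_padicBall (p := p) (e + 1 - i)) (t := 1) (by omega)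
  have h3 := div_natCast_mem_padicBall h2 (m := e + 1) (by omega) he
  push_cast at h3
  exact h3

theorem one_div_pow_sub_pow_mem_padicBall {k s : ℕ} (hk : k + 1 < p) (hs : s ≤ p - 1) :
    1 / ((k : ℚ) + 1) ^ s - ((k : ℚ) + 1) ^ (p - 1 - s) ∈ padicBall p 1 := by
  have hfermat : ((k : ℚ) + 1) ^ (p - 1) - 1 ∈ padicBall p 1 := by
    have h0 : ((k + 1 : ℕ) : ZMod p) ≠ 0 := by
      rw [Ne, ZMod.natCast_eq_zero_iff]
      exact Nat.not_dvd_of_pos_of_lt k.succ_pos hk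
    have h1 := ZMod.pow_card_sub_one_eq_one h0
    have h2 : (p : ℤ) ^ 1 ∣ ((k : ℤ) + 1) ^ (p - 1) - 1 := by
      rw [pow_one, ← ZMod.intCast_zmod_eq_zero_iff_dvd]
      push_cast at h1 ⊢
      rw [h1, sub_self]
    have h3 := (padicNorm.dvd_iff_norm_le (p := p)).1 (by exact_mod_cast h2)
    rw [mem_padicBall]
    push_cast at h3
    exact h3
  have hmul := mul_mem_padicBall hfermat (one_div_succ_pow_mem_padicBall hk s) (t := 1) (by simp)
  have hne : (k : ℚ) + 1 ≠ 0 := by positivity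
  have hpow : ((k : ℚ) + 1) ^ (p - 1) = ((k : ℚ) + 1) ^ s * ((k : ℚ) + 1) ^ (p - 1 - s) := by
    rw [← pow_add]; congr 1; omega
  convert AddSubgroup.neg_mem _ hmul using 1
  rw [hpow]
  field_simp
  ring

theorem powHarmonic_pred_mem_padicBall_one {s : ℕ} (hs : 0 < s) (hsp : s + 1 < p) :
    powHarmonic s (p - 1) ∈ padicBall p 1 := by
  have h1 : ∑ k ∈ Finset.range (p - 1), (1 / ((k : ℚ) + 1) ^ s - ((k : ℚ) + 1) ^ (p - 1 - s)) ∈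
      padicBall p 1 :=
    AddSubgroup.sum_mem _ fun k hk => one_div_pow_sub_pow_mem_padicBall
      (by have := Finset.mem_range.1 hk; omega) (by omega)
  rw [Finset.sum_sub_distrib] at h1
  have h2 := sum_range_pow_mem_padicBall (p := p) (e := p - 1 - s) (by omega) (by omega)
  have h3 := AddSubgroup.add_mem _ h1 h2
  rwa [sub_add_cancel] at h3

theorem one_div_sub_pow_mem_padicBall {k : ℕ} (hk : k < p - 1) (s : ℕ) :
    1 / ((p : ℚ) - (k + 1)) ^ s ∈ padicBall p 0 := by
  rw [← cast_sub_one_sub hk]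
  exact one_div_succ_pow_mem_padicBall (by omega) s

/-- The symmetry `k ↦ p - k`, with `1/(p-k)` expanded in powers of `p/k`. -/
theorem two_mul_powHarmonic_one_mem :
    2 * powHarmonic 1 (p - 1) + p * powHarmonic 2 (p - 1) + p ^ 2 * powHarmonic 3 (p - 1) +
      p ^ 3 * powHarmonic 4 (p - 1) + p ^ 4 * powHarmonic 5 (p - 1) ∈ padicBall p 5 := by
  have h : 2 * powHarmonic 1 (p - 1) = powHarmonic 1 (p - 1) +
      ∑ k ∈ Finset.range (p - 1), 1 / ((p : ℚ) - (k + 1)) ^ 1 := by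
    rw [← powHarmonic_reflect]; ring
  rw [h]
  simp only [powHarmonic, Finset.mul_sum, ← Finset.sum_add_distrib]
  refine AddSubgroup.sum_mem _ fun k hk => ?_
  have hk := Finset.mem_range.1 hk
  have h1 := mul_mem_padicBall (one_div_succ_pow_mem_padicBall (p := p) (k := k) (by omega) 5)
    (one_div_sub_pow_mem_padicBall hk 1) (t := 0) (by simp)
  have h2 := prime_pow_mul_mem_padicBall 5 h1 (t := 5) (by simp)
  convert h2 using 1
  have : (k : ℚ) + 1 ≠ 0 := by positivity
  have : (p : ℚ) - (k + 1) ≠ 0 := by rw [← cast_sub_one_sub hk]; positivity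
  field_simp
  ring

/-- The symmetry `k ↦ p - k` for the third powers. -/
theorem two_mul_powHarmonic_three_mem :
    2 * powHarmonic 3 (p - 1) + 3 * p * powHarmonic 4 (p - 1) +
      6 * p ^ 2 * powHarmonic 5 (p - 1) ∈ padicBall p 3 := by
  have h : 2 * powHarmonic 3 (p - 1) = powHarmonic 3 (p - 1) +
      ∑ k ∈ Finset.range (p - 1), 1 / ((p : ℚ) - (k + 1)) ^ 3 := by
    rw [← powHarmonic_reflect]; ring
  rw [h]
  simp only [powHarmonic, Finset.mul_sum, ← Finset.sum_add_distrib]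
  refine AddSubgroup.sum_mem _ fun k hk => ?_
  have hk := Finset.mem_range.1 hk
  have hp0 : (p : ℚ) ∈ padicBall p 0 := natCast_mem_padicBall p
  have hk0 : ((k + 1 : ℕ) : ℚ) ∈ padicBall p 0 := natCast_mem_padicBall _
  have hnum : (6 : ℕ) * (p : ℚ) ^ 2 - (15 : ℕ) * (p * (k + 1 : ℕ)) +
      (10 : ℕ) * ((k + 1 : ℕ) : ℚ) ^ 2 ∈ padicBall p 0 :=
    AddSubgroup.add_mem _ (AddSubgroup.sub_mem _
      (natCast_mul_mem_padicBall 6 (pow_mem_padicBall hp0 2))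
      (natCast_mul_mem_padicBall 15 (mul_mem_padicBall hp0 hk0 (by simp))))
      (natCast_mul_mem_padicBall 10 (pow_mem_padicBall hk0 2))
  have h1 := mul_mem_padicBall (one_div_succ_pow_mem_padicBall (p := p) (k := k) (by omega) 5)
    (one_div_sub_pow_mem_padicBall hk 3) (t := 0) (by simp)
  have h2 := prime_pow_mul_mem_padicBall 3 (mul_mem_padicBall hnum h1 (t := 0) (by simp)) (t := 3)
    (by simp)
  convert h2 using 1
  have : (k : ℚ) + 1 ≠ 0 := by positivity
  have : (p : ℚ) - (k + 1) ≠ 0 := by rw [← cast_sub_one_sub hk]; positivity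
  push_cast
  field_simp
  ring

end padicBall

/-! ### `p`-adic expansions of binomial coefficients -/

theorem prod_one_add_mul_invBinom (n k : ℕ) :
    (∏ m ∈ Finset.range k, (1 + (n : ℚ) * (1 / ((m : ℚ) + 1)))) * invBinom n k = 1 := by
  induction k with
  | zero => simp
  | succ k ih =>
    rw [Finset.prod_range_succ, invBinom_succ_right, mul_mul_mul_comm, ih, one_mul]
    have : (k : ℚ) + 1 ≠ 0 := by positivity
    have : (n : ℚ) + k + 1 ≠ 0 := by positivity
    field_simp
    ring

theorem neg_one_pow_mul_choose {n k : ℕ} (hk : k ≤ n) :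
    (-1) ^ k * (n.choose k : ℚ) =
      ∏ m ∈ Finset.range k, (1 + (-((n : ℚ) + 1)) * (1 / ((m : ℚ) + 1))) := by
  induction k with
  | zero => simp
  | succ k ih =>
    rw [Finset.prod_range_succ, ← ih (by omega)]
    have h := congrArg (Nat.cast : ℕ → ℚ) (Nat.choose_succ_right_eq n k)
    push_cast [Nat.cast_sub (show k ≤ n by omega)] at h
    have : (k : ℚ) + 1 ≠ 0 := by positivity
    field_simp
    rw [pow_succ]
    linear_combination (-(-1) ^ k : ℚ) * h

section expansions

variable {p : ℕ} [Fact p.Prime]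

theorem invBinom_mem_padicBall {k : ℕ} (hk : k < p) : invBinom p k ∈ padicBall p 0 := by
  induction k with
  | zero => simpa using one_mem_padicBall
  | succ k ih =>
    rw [invBinom_succ_right]
    refine mul_mem_padicBall (ih (by omega)) (s := 0) ?_ (by simp)
    have hd : ¬ p ∣ p + k + 1 := by
      rw [add_assoc, Nat.dvd_add_right dvd_rfl]
      exact Nat.not_dvd_of_pos_of_lt k.succ_pos hk
    have := mul_mem_padicBall (natCast_mem_padicBall (p := p) (k + 1))
      (one_div_natCast_mem_padicBall hd) (t := 0) (by simp)
    push_cast at this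
    rwa [← div_eq_mul_one_div] at this

/-- Second-order expansion of `C(p+k, k)⁻¹ = ∏_{m ≤ k} (1 + p/m)⁻¹`. -/
theorem invBinom_sub_mem_padicBall (hp2 : 2 < p) {k : ℕ} (hk : k < p) :
    invBinom p k - (1 - p * powHarmonic 1 k +
      p ^ 2 * (powHarmonic 1 k ^ 2 + powHarmonic 2 k) / 2) ∈ padicBall p 3 := by
  have h := prod_one_add_mul_sub_mem_padicBall hp2 (s := 1) (by simpa using prime_mem_padicBall)
    (fun m => 1 / ((m : ℚ) + 1)) k fun m hm => by
      simpa using one_div_succ_pow_mem_padicBall (p := p) (k := m) (by omega) 1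
  have hv := invBinom_mem_padicBall hk
  have hprod := prod_one_add_mul_invBinom p k
  have e1 : ∑ m ∈ Finset.range k, 1 / ((m : ℚ) + 1) = powHarmonic 1 k := by simp [powHarmonic]
  have e2 : ∑ m ∈ Finset.range k, (1 / ((m : ℚ) + 1)) ^ 2 = powHarmonic 2 k := by
    simp [powHarmonic]
  simp only [e1, e2] at h
  have h1 := powHarmonic_mem_padicBall hk 1
  have h2 := powHarmonic_mem_padicBall hk 2
  generalize ∏ m ∈ Finset.range k, (1 + (p : ℚ) * (1 / ((m : ℚ) + 1))) = P at *
  generalize powHarmonic 1 k = A at *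
  generalize powHarmonic 2 k = B at *
  generalize invBinom p k = v at *
  have hp0 : (p : ℚ) ∈ padicBall p 0 := natCast_mem_padicBall p
  have hA2 := pow_mem_padicBall h1 2
  have ha : (A ^ 2 - B) / (2 : ℕ) ∈ padicBall p 0 :=
    div_natCast_mem_padicBall (AddSubgroup.sub_mem _ hA2 h2) (by norm_num) hp2
  have hb : (A ^ 2 + B) / (2 : ℕ) ∈ padicBall p 0 :=
    div_natCast_mem_padicBall (AddSubgroup.add_mem _ hA2 h2) (by norm_num) hp2
  have hB : 1 - p * A + p ^ 2 * ((A ^ 2 + B) / (2 : ℕ)) ∈ padicBall p 0 :=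
    AddSubgroup.add_mem _ (AddSubgroup.sub_mem _ one_mem_padicBall
      (mul_mem_padicBall hp0 h1 (by simp))) (mul_mem_padicBall (pow_mem_padicBall hp0 2) hb
        (by simp))
  have t1 := mul_mem_padicBall hv (mul_mem_padicBall h hB (t := 3) (by simp)) (t := 3) (by simp)
  have t2 : (p : ℚ) ^ 3 * (A * B + p * ((A ^ 2 - B) / (2 : ℕ) * ((A ^ 2 + B) / (2 : ℕ)))) ∈
      padicBall p 3 :=
    prime_pow_mul_mem_padicBall 3 (AddSubgroup.add_mem _ (mul_mem_padicBall h1 h2 le_rfl)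
      (mul_mem_padicBall hp0 (mul_mem_padicBall ha hb le_rfl) (by simp))) (by simp)
  have t3 := mul_mem_padicBall hv t2 (t := 3) (by simp)
  convert AddSubgroup.neg_mem _ (AddSubgroup.add_mem _ t1 t3) using 1
  push_cast
  linear_combination (1 - p * A + p ^ 2 * (A ^ 2 + B) / 2) * hprod

theorem neg_one_pow_mul_choose_sub_mem_padicBall (hp2 : 2 < p) {k : ℕ} (hk : k ≤ p - 1) :
    (-1) ^ k * ((p - 1).choose k : ℚ) - (1 - p * powHarmonic 1 k +
      p ^ 2 * ((powHarmonic 1 k ^ 2 - powHarmonic 2 k) / 2)) ∈ padicBall p 3 := by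
  have h := prod_one_add_mul_sub_mem_padicBall hp2 (s := 1) (x := -(p : ℚ))
    (AddSubgroup.neg_mem _ (by simpa using prime_mem_padicBall))
    (fun m => 1 / ((m : ℚ) + 1)) k fun m hm => by
      simpa using one_div_succ_pow_mem_padicBall (p := p) (k := m) (by omega) 1
  have e1 : ∑ m ∈ Finset.range k, 1 / ((m : ℚ) + 1) = powHarmonic 1 k := by simp [powHarmonic]
  have e2 : ∑ m ∈ Finset.range k, (1 / ((m : ℚ) + 1)) ^ 2 = powHarmonic 2 k := by
    simp [powHarmonic]
  have e3 : ((p - 1 : ℕ) : ℚ) + 1 = p := by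
    exact_mod_cast congrArg (Nat.cast : ℕ → ℚ) (show p - 1 + 1 = p by omega)
  rw [neg_one_pow_mul_choose hk, e3]
  simp only [e1, e2] at h
  rw [show 1 - p * powHarmonic 1 k + (p : ℚ) ^ 2 * ((powHarmonic 1 k ^ 2 - powHarmonic 2 k) / 2) =
    1 + -(p : ℚ) * powHarmonic 1 k +
      (-(p : ℚ)) ^ 2 * (powHarmonic 1 k ^ 2 - powHarmonic 2 k) / 2 by ring]
  exact h

/-- Since `(-1)^k C(p-1, k) = ∏_{m ≤ k} (1 - p/m)`, the binomial transform at `p - 1` expands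
`p`-adically in harmonic-weighted sums of the sequence. -/
theorem binomTransform_pred_mem_padicBall (hp2 : 2 < p) (x : ℕ → ℚ)
    (hx : ∀ k < p - 1, x k ∈ padicBall p 0) :
    binomTransform x (p - 1) + ∑ k ∈ Finset.range (p - 1), x k -
      p * ∑ k ∈ Finset.range (p - 1), powHarmonic 1 (k + 1) * x k +
      p ^ 2 * ∑ k ∈ Finset.range (p - 1),
        (powHarmonic 1 (k + 1) ^ 2 - powHarmonic 2 (k + 1)) / 2 * x k ∈ padicBall p 3 := by
  rw [binomTransform, Finset.mul_sum, Finset.mul_sum, ← Finset.sum_add_distrib,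
    ← Finset.sum_sub_distrib, ← Finset.sum_add_distrib]
  refine AddSubgroup.sum_mem _ fun k hk => ?_
  have hk := Finset.mem_range.1 hk
  have h := mul_mem_padicBall (neg_one_pow_mul_choose_sub_mem_padicBall hp2
    (show k + 1 ≤ p - 1 by omega)) (hx k hk) (t := 3) (by simp)
  convert AddSubgroup.neg_mem _ h using 1
  ring

theorem half_sq_sub_mem_padicBall (hp2 : 2 < p) {k : ℕ} (hk : k < p) :
    (powHarmonic 1 k ^ 2 - powHarmonic 2 k) / 2 ∈ padicBall p 0 := by
  have := div_natCast_mem_padicBall (AddSubgroup.sub_mem _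
    (pow_mem_padicBall (powHarmonic_mem_padicBall hk 1) 2) (powHarmonic_mem_padicBall hk 2))
    (m := 2) (by norm_num) hp2
  exact_mod_cast this

theorem binomTransform_pred_mem_padicBall_two (hp2 : 2 < p) (x : ℕ → ℚ)
    (hx : ∀ k < p - 1, x k ∈ padicBall p 0) :
    binomTransform x (p - 1) + ∑ k ∈ Finset.range (p - 1), x k -
      p * ∑ k ∈ Finset.range (p - 1), powHarmonic 1 (k + 1) * x k ∈ padicBall p 2 := by
  have h := binomTransform_pred_mem_padicBall hp2 x hx
  have h2 : ∑ k ∈ Finset.range (p - 1),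
      (powHarmonic 1 (k + 1) ^ 2 - powHarmonic 2 (k + 1)) / 2 * x k ∈ padicBall p 0 :=
    AddSubgroup.sum_mem _ fun k hk => by
      have hk := Finset.mem_range.1 hk
      exact mul_mem_padicBall (half_sq_sub_mem_padicBall hp2 (by omega)) (hx k hk) (by simp)
  have h3 := AddSubgroup.sub_mem _ (padicBall_anti (by norm_num : (2 : ℤ) ≤ 3) h)
    (prime_pow_mul_mem_padicBall 2 h2 (t := 2) (by simp))
  simpa using h3

theorem binomTransform_pred_mem_padicBall_one (hp2 : 2 < p) (x : ℕ → ℚ)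
    (hx : ∀ k < p - 1, x k ∈ padicBall p 0) :
    binomTransform x (p - 1) + ∑ k ∈ Finset.range (p - 1), x k ∈ padicBall p 1 := by
  have h := binomTransform_pred_mem_padicBall_two hp2 x hx
  have h2 : ∑ k ∈ Finset.range (p - 1), powHarmonic 1 (k + 1) * x k ∈ padicBall p 0 :=
    AddSubgroup.sum_mem _ fun k hk => by
      have hk := Finset.mem_range.1 hk
      exact mul_mem_padicBall (powHarmonic_mem_padicBall (by omega) 1) (hx k hk) (by simp)
  have h3 := AddSubgroup.add_mem _ (padicBall_anti (by norm_num : (1 : ℤ) ≤ 2) h)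
    (mul_mem_padicBall prime_mem_padicBall h2 (t := 1) (by simp))
  simpa using h3

end expansions

/-! ### Harmonic sums modulo powers of `p` -/

section powerSums

variable {p : ℕ} [Fact p.Prime]

theorem powHarmonic_three_pred_mem (h5 : 5 < p) : powHarmonic 3 (p - 1) ∈ padicBall p 2 := by
  have h4 := powHarmonic_pred_mem_padicBall_one (p := p) (s := 4) (by norm_num) (by omega)
  have hh5 := powHarmonic_mem_padicBall (p := p) (n := p - 1) (by omega) 5
  have t1 := natCast_mul_mem_padicBall 3 (mul_mem_padicBall prime_mem_padicBall h4 (t := 2)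
    (by norm_num))
  have t2 := natCast_mul_mem_padicBall 6 (prime_pow_mul_mem_padicBall 2 hh5 (t := 2) (by simp))
  have t3 := padicBall_anti (by norm_num : (2 : ℤ) ≤ 3) (two_mul_powHarmonic_three_mem (p := p))
  have t4 := div_natCast_mem_padicBall (AddSubgroup.sub_mem _ (AddSubgroup.sub_mem _ t3 t1) t2)
    (m := 2) (by norm_num) (by omega)
  convert t4 using 1
  push_cast
  ring

theorem powHarmonic_one_pred_mem (h5 : 5 < p) : powHarmonic 1 (p - 1) ∈ padicBall p 2 := by
  have h2 := powHarmonic_pred_mem_padicBall_one (p := p) (s := 2) (by norm_num) (by omega)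
  have hh (s : ℕ) := powHarmonic_mem_padicBall (p := p) (n := p - 1) (by omega) s
  have t1 := mul_mem_padicBall prime_mem_padicBall h2 (t := 2) (by norm_num)
  have t2 := prime_pow_mul_mem_padicBall 2 (hh 3) (t := 2) (by simp)
  have t3 := prime_pow_mul_mem_padicBall 3 (hh 4) (t := 2) (by simp)
  have t4 := prime_pow_mul_mem_padicBall 4 (hh 5) (t := 2) (by simp)
  have t5 := padicBall_anti (by norm_num : (2 : ℤ) ≤ 5) (two_mul_powHarmonic_one_mem (p := p))
  have t6 := div_natCast_mem_padicBall (AddSubgroup.sub_mem _ (AddSubgroup.sub_mem _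
    (AddSubgroup.sub_mem _ (AddSubgroup.sub_mem _ t5 t1) t2) t3) t4)
    (m := 2) (by norm_num) (by omega)
  convert t6 using 1
  push_cast
  ring

theorem one_div_add_one_div_sub_mem {k : ℕ} (hk : k < p - 1) :
    1 / ((k : ℚ) + 1) + 1 / ((p : ℚ) - (k + 1)) ∈ padicBall p 1 := by
  have h1 := mul_mem_padicBall (one_div_succ_pow_mem_padicBall (p := p) (k := k) (by omega) 1)
    (one_div_sub_pow_mem_padicBall hk 1) (t := 0) (by simp)
  convert mul_mem_padicBall prime_mem_padicBall h1 (t := 1) (by simp) using 1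
  have : (k : ℚ) + 1 ≠ 0 := by positivity
  have : (p : ℚ) - (k + 1) ≠ 0 := by rw [← cast_sub_one_sub hk]; positivity
  field_simp
  ring

theorem one_div_cube_add_one_div_sub_cube_mem {k : ℕ} (hk : k < p - 1) :
    1 / ((k : ℚ) + 1) ^ 3 + 1 / ((p : ℚ) - (k + 1)) ^ 3 ∈ padicBall p 1 := by
  have hx : 1 / ((k : ℚ) + 1) ∈ padicBall p 0 := by
    simpa using one_div_succ_pow_mem_padicBall (p := p) (k := k) (by omega) 1
  have hy : 1 / ((p : ℚ) - (k + 1)) ∈ padicBall p 0 := by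
    simpa using one_div_sub_pow_mem_padicBall hk 1
  have h := one_div_add_one_div_sub_mem hk
  simp only [← one_div_pow]
  generalize 1 / ((k : ℚ) + 1) = x at *
  generalize 1 / ((p : ℚ) - (k + 1)) = y at *
  convert mul_mem_padicBall h (AddSubgroup.add_mem _ (AddSubgroup.sub_mem _
    (pow_mem_padicBall hx 2) (mul_mem_padicBall hx hy (t := 0) (by simp)))
    (pow_mem_padicBall hy 2)) (t := 1) (by simp) using 1
  ring

theorem powHarmonic_three_reflect (h5 : 5 < p) {k : ℕ} (hk : k ≤ p - 1) :
    powHarmonic 3 (p - 1 - k) - powHarmonic 3 k ∈ padicBall p 1 := by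
  induction k with
  | zero =>
    simpa using powHarmonic_pred_mem_padicBall_one (p := p) (s := 3) (by norm_num) (by omega)
  | succ k ih =>
    have h1 := ih (by omega)
    have h2 := one_div_cube_add_one_div_sub_cube_mem (p := p) (k := k) (by omega)
    have e : p - 1 - k = p - 1 - 1 - k + 1 := by omega
    have e' : p - 1 - (k + 1) = p - 1 - 1 - k := by omega
    rw [e, powHarmonic_succ, cast_sub_one_sub (by omega)] at h1
    rw [e', powHarmonic_succ]
    convert AddSubgroup.sub_mem _ h1 h2 using 1
    ring

/-- Modulo `p`, the reflection `k ↦ p - k` sends the sum to its negative plus `H^{(4)}`, and `2` is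
invertible. -/
theorem sum_powHarmonic_three_div_mem (h5 : 5 < p) :
    ∑ k ∈ Finset.range (p - 1), powHarmonic 3 (k + 1) / ((k : ℚ) + 1) ∈ padicBall p 1 := by
  have hsplit : ∑ k ∈ Finset.range (p - 1), powHarmonic 3 (k + 1) / ((k : ℚ) + 1) =
      ∑ k ∈ Finset.range (p - 1), powHarmonic 3 k / ((k : ℚ) + 1) + powHarmonic 4 (p - 1) := by
    rw [powHarmonic, ← Finset.sum_add_distrib]
    refine Finset.sum_congr rfl fun k _ => ?_
    rw [powHarmonic_succ]
    have : (k : ℚ) + 1 ≠ 0 := by positivity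
    field_simp
  have hrefl : ∑ k ∈ Finset.range (p - 1), powHarmonic 3 (k + 1) / ((k : ℚ) + 1) =
      ∑ k ∈ Finset.range (p - 1), powHarmonic 3 (p - 1 - k) / ((p : ℚ) - (k + 1)) := by
    rw [← Finset.sum_range_reflect]
    refine Finset.sum_congr rfl fun k hk => ?_
    have hk := Finset.mem_range.1 hk
    rw [cast_sub_one_sub hk, show p - 1 - 1 - k + 1 = p - 1 - k by omega]
  have hdiff : ∑ k ∈ Finset.range (p - 1), powHarmonic 3 (p - 1 - k) / ((p : ℚ) - (k + 1)) +
      ∑ k ∈ Finset.range (p - 1), powHarmonic 3 k / ((k : ℚ) + 1) ∈ padicBall p 1 := by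
    rw [← Finset.sum_add_distrib]
    refine AddSubgroup.sum_mem _ fun k hk => ?_
    have hk := Finset.mem_range.1 hk
    have h1 := mul_mem_padicBall (powHarmonic_three_reflect (p := p) (k := k) h5 (by omega))
      (one_div_sub_pow_mem_padicBall hk 1) (t := 1) (by simp)
    have h2 := mul_mem_padicBall (powHarmonic_mem_padicBall (p := p) (n := k) (by omega) 3)
      (one_div_add_one_div_sub_mem hk) (t := 1) (by simp)
    convert AddSubgroup.add_mem _ h1 h2 using 1
    ring
  have h4 := powHarmonic_pred_mem_padicBall_one (p := p) (s := 4) (by norm_num) (by omega)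
  rw [← hrefl] at hdiff
  have h := div_natCast_mem_padicBall (AddSubgroup.add_mem _ hdiff h4) (m := 2) (by norm_num)
    (by omega)
  convert h using 1
  push_cast
  linear_combination hsplit / 2

theorem sum_powHarmonic_two_div_sq_mem (h5 : 5 < p) :
    ∑ k ∈ Finset.range (p - 1), powHarmonic 2 (k + 1) / ((k : ℚ) + 1) ^ 2 ∈ padicBall p 1 := by
  have h2 := powHarmonic_pred_mem_padicBall_one (p := p) (s := 2) (by norm_num) (by omega)
  have h4 := powHarmonic_pred_mem_padicBall_one (p := p) (s := 4) (by norm_num) (by omega)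
  rw [sum_powHarmonic_two_div_sq, sq]
  exact_mod_cast div_natCast_mem_padicBall (AddSubgroup.add_mem _
    (mul_mem_padicBall h2 h2 (by norm_num)) h4) (m := 2) (by norm_num) (by omega)

/-- The weight-four sum `∑ H_k² / k²` vanishes modulo `p`. As `(-1)^k C(p-1, k) ≡ 1`, summing a sequence
is the same modulo `p` as minus its binomial transform, which for `starHarmonic 2 k / k²` is the
depth-two sum `∑ H_k^{(3)}/k`. -/
theorem sum_powHarmonic_one_sq_div_sq_mem (h5 : 5 < p) :
    ∑ k ∈ Finset.range (p - 1), powHarmonic 1 (k + 1) ^ 2 / ((k : ℚ) + 1) ^ 2 ∈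
      padicBall p 1 := by
  have hx : ∀ k < p - 1, starHarmonic 2 (k + 1) / ((k : ℚ) + 1) ^ 2 ∈ padicBall p 0 := by
    intro k hk
    have h0 := div_natCast_mem_padicBall (AddSubgroup.add_mem _
      (pow_mem_padicBall (powHarmonic_mem_padicBall (p := p) (n := k + 1) (by omega) 1) 2)
      (powHarmonic_mem_padicBall (p := p) (n := k + 1) (by omega) 2)) (m := 2) (by norm_num)
      (by omega)
    rw [starHarmonic_two, div_eq_mul_one_div]
    exact mul_mem_padicBall (by exact_mod_cast h0)
      (one_div_succ_pow_mem_padicBall (by omega) 2) (by simp)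
  have h := binomTransform_pred_mem_padicBall_one (by omega) _ hx
  rw [binomTransform_starHarmonic_div_sq] at h
  have h' := AddSubgroup.sub_mem _ h (sum_powHarmonic_three_div_mem h5)
  rw [add_sub_cancel_left] at h'
  have h'' := AddSubgroup.sub_mem _ (natCast_mul_mem_padicBall 2 h')
    (sum_powHarmonic_two_div_sq_mem h5)
  convert h'' using 1
  rw [Finset.mul_sum, ← Finset.sum_sub_distrib]
  refine Finset.sum_congr rfl fun k _ => ?_
  rw [starHarmonic_two]
  push_cast
  ring

/-- Comparison of the exact transform of `1/k²` at `p - 1` with its `p`-adic expansion. -/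
theorem prime_mul_sum_powHarmonic_one_div_sq_sub_mem (h5 : 5 < p) :
    p * ∑ k ∈ Finset.range (p - 1), powHarmonic 1 (k + 1) / ((k : ℚ) + 1) ^ 2 -
      3 / 2 * powHarmonic 2 (p - 1) ∈ padicBall p 3 := by
  have h := binomTransform_pred_mem_padicBall (p := p) (by omega)
    (fun k => 1 / ((k : ℚ) + 1) ^ 2) fun k hk => one_div_succ_pow_mem_padicBall (by omega) 2
  have e := binomTransform_one_div_pow 2 (p - 1 - 1)
  rw [show p - 1 - 1 + 1 = p - 1 by omega] at e
  rw [e, starHarmonic_two] at h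
  have hY := sum_powHarmonic_one_sq_div_sq_mem h5
  have hZ := sum_powHarmonic_two_div_sq_mem h5
  have hYZ : ∑ k ∈ Finset.range (p - 1),
      (powHarmonic 1 (k + 1) ^ 2 - powHarmonic 2 (k + 1)) / 2 * (1 / ((k : ℚ) + 1) ^ 2) =
      (∑ k ∈ Finset.range (p - 1), powHarmonic 1 (k + 1) ^ 2 / ((k : ℚ) + 1) ^ 2 -
        ∑ k ∈ Finset.range (p - 1), powHarmonic 2 (k + 1) / ((k : ℚ) + 1) ^ 2) / ((2 : ℕ) : ℚ) := by
    rw [← Finset.sum_sub_distrib, Finset.sum_div]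
    exact Finset.sum_congr rfl fun k _ => by push_cast; ring
  rw [hYZ] at h
  have h1 := prime_pow_mul_mem_padicBall 2 (div_natCast_mem_padicBall
    (AddSubgroup.sub_mem _ hY hZ) (m := 2) (by norm_num) (by omega)) (t := 3) (by simp)
  have hH1 := powHarmonic_one_pred_mem h5
  have h2 := div_natCast_mem_padicBall (mul_mem_padicBall hH1 hH1 (t := 3) (by norm_num))
    (m := 2) (by norm_num) (by omega)
  convert AddSubgroup.sub_mem _ (AddSubgroup.add_mem _ h1 h2) h using 1
  simp only [mul_one_div]
  rw [show ∑ k ∈ Finset.range (p - 1), 1 / ((k : ℚ) + 1) ^ 2 = powHarmonic 2 (p - 1) from rfl]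
  push_cast
  ring

theorem sum_invBinom_div_sq_add_mem (h5 : 5 < p) :
    ∑ k ∈ Finset.range (p - 1), invBinom p (k + 1) / ((k : ℚ) + 1) ^ 2 +
      powHarmonic 2 (p - 1) / 2 ∈ padicBall p 3 := by
  have h : ∑ k ∈ Finset.range (p - 1), (invBinom p (k + 1) - (1 - p * powHarmonic 1 (k + 1) +
      p ^ 2 * (powHarmonic 1 (k + 1) ^ 2 + powHarmonic 2 (k + 1)) / 2)) *
      (1 / ((k : ℚ) + 1) ^ 2) ∈ padicBall p 3 := by
    refine AddSubgroup.sum_mem _ fun k hk => ?_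
    have hk := Finset.mem_range.1 hk
    exact mul_mem_padicBall (invBinom_sub_mem_padicBall (by omega) (by omega))
      (one_div_succ_pow_mem_padicBall (by omega) 2) (by simp)
  have hX := prime_mul_sum_powHarmonic_one_div_sq_sub_mem h5
  have hYZ := prime_pow_mul_mem_padicBall 2 (div_natCast_mem_padicBall (AddSubgroup.add_mem _
    (sum_powHarmonic_one_sq_div_sq_mem h5) (sum_powHarmonic_two_div_sq_mem h5)) (m := 2)
    (by norm_num) (by omega)) (t := 3) (by simp)
  convert AddSubgroup.add_mem _ (AddSubgroup.sub_mem _ h hX) hYZ using 1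
  have e : ∑ k ∈ Finset.range (p - 1), (invBinom p (k + 1) - (1 - p * powHarmonic 1 (k + 1) +
      p ^ 2 * (powHarmonic 1 (k + 1) ^ 2 + powHarmonic 2 (k + 1)) / 2)) *
      (1 / ((k : ℚ) + 1) ^ 2) =
      ∑ k ∈ Finset.range (p - 1), invBinom p (k + 1) / ((k : ℚ) + 1) ^ 2 -
      powHarmonic 2 (p - 1) +
      p * ∑ k ∈ Finset.range (p - 1), powHarmonic 1 (k + 1) / ((k : ℚ) + 1) ^ 2 -
      p ^ 2 / 2 * (∑ k ∈ Finset.range (p - 1), powHarmonic 1 (k + 1) ^ 2 / ((k : ℚ) + 1) ^ 2 +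
        ∑ k ∈ Finset.range (p - 1), powHarmonic 2 (k + 1) / ((k : ℚ) + 1) ^ 2) := by
    rw [powHarmonic, ← Finset.sum_add_distrib, Finset.mul_sum, Finset.mul_sum,
      ← Finset.sum_sub_distrib, ← Finset.sum_add_distrib, ← Finset.sum_sub_distrib]
    exact Finset.sum_congr rfl fun k _ => by ring
  rw [e]
  push_cast
  ring

theorem sum_invBinom_sq_div_sq_add_mem (h5 : 5 < p) :
    ∑ k ∈ Finset.range (p - 1), invBinom p (k + 1) ^ 2 / ((k : ℚ) + 1) ^ 2 +
      2 * powHarmonic 2 (p - 1) ∈ padicBall p 3 := by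
  have hp0 : (p : ℚ) ∈ padicBall p 0 := natCast_mem_padicBall p
  have hsq : ∀ k < p - 1, invBinom p (k + 1) ^ 2 - (1 - 2 * p * powHarmonic 1 (k + 1) +
      p ^ 2 * (2 * powHarmonic 1 (k + 1) ^ 2 + powHarmonic 2 (k + 1))) ∈ padicBall p 3 := by
    intro k hk
    have h := invBinom_sub_mem_padicBall (p := p) (k := k + 1) (by omega) (by omega)
    have hv := invBinom_mem_padicBall (p := p) (k := k + 1) (by omega)
    have h1 := powHarmonic_mem_padicBall (p := p) (n := k + 1) (by omega) 1
    have h2 := powHarmonic_mem_padicBall (p := p) (n := k + 1) (by omega) 2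
    generalize powHarmonic 1 (k + 1) = A at *
    generalize powHarmonic 2 (k + 1) = B at *
    generalize invBinom p (k + 1) = v at *
    have hb : (A ^ 2 + B) / (2 : ℕ) ∈ padicBall p 0 :=
      div_natCast_mem_padicBall (AddSubgroup.add_mem _ (pow_mem_padicBall h1 2) h2) (by norm_num)
        (by omega)
    have hB : 1 - p * A + p ^ 2 * ((A ^ 2 + B) / (2 : ℕ)) ∈ padicBall p 0 :=
      AddSubgroup.add_mem _ (AddSubgroup.sub_mem _ one_mem_padicBall
        (mul_mem_padicBall hp0 h1 (by simp))) (mul_mem_padicBall (pow_mem_padicBall hp0 2) hb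
          (by simp))
    have t1 := mul_mem_padicBall h (AddSubgroup.add_mem _ hv hB) (t := 3) (by simp)
    have t2 : (p : ℚ) ^ 3 * (p * ((A ^ 2 + B) / (2 : ℕ)) ^ 2 - A * (A ^ 2 + B)) ∈
        padicBall p 3 :=
      prime_pow_mul_mem_padicBall 3 (AddSubgroup.sub_mem _
        (mul_mem_padicBall hp0 (pow_mem_padicBall hb 2) (t := 0) (by simp))
        (mul_mem_padicBall h1 (AddSubgroup.add_mem _ (pow_mem_padicBall h1 2) h2) (by simp)))
        (by simp)
    convert AddSubgroup.add_mem _ t1 t2 using 1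
    push_cast
    ring
  have h : ∑ k ∈ Finset.range (p - 1), (invBinom p (k + 1) ^ 2 -
      (1 - 2 * p * powHarmonic 1 (k + 1) +
      p ^ 2 * (2 * powHarmonic 1 (k + 1) ^ 2 + powHarmonic 2 (k + 1)))) *
      (1 / ((k : ℚ) + 1) ^ 2) ∈ padicBall p 3 := by
    refine AddSubgroup.sum_mem _ fun k hk => ?_
    have hk := Finset.mem_range.1 hk
    exact mul_mem_padicBall (hsq k hk) (one_div_succ_pow_mem_padicBall (by omega) 2) (by simp)
  have hX := natCast_mul_mem_padicBall 2 (prime_mul_sum_powHarmonic_one_div_sq_sub_mem h5)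
  have hYZ := prime_pow_mul_mem_padicBall 2 (AddSubgroup.add_mem _
    (natCast_mul_mem_padicBall 2 (sum_powHarmonic_one_sq_div_sq_mem h5))
    (sum_powHarmonic_two_div_sq_mem h5)) (t := 3) (by simp)
  convert AddSubgroup.add_mem _ (AddSubgroup.sub_mem _ h hX) hYZ using 1
  have e : ∑ k ∈ Finset.range (p - 1), (invBinom p (k + 1) ^ 2 -
      (1 - 2 * p * powHarmonic 1 (k + 1) +
      p ^ 2 * (2 * powHarmonic 1 (k + 1) ^ 2 + powHarmonic 2 (k + 1)))) *
      (1 / ((k : ℚ) + 1) ^ 2) =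
      ∑ k ∈ Finset.range (p - 1), invBinom p (k + 1) ^ 2 / ((k : ℚ) + 1) ^ 2 -
      powHarmonic 2 (p - 1) +
      2 * p * ∑ k ∈ Finset.range (p - 1), powHarmonic 1 (k + 1) / ((k : ℚ) + 1) ^ 2 -
      p ^ 2 * (2 * ∑ k ∈ Finset.range (p - 1), powHarmonic 1 (k + 1) ^ 2 / ((k : ℚ) + 1) ^ 2 +
        ∑ k ∈ Finset.range (p - 1), powHarmonic 2 (k + 1) / ((k : ℚ) + 1) ^ 2) := by
    rw [powHarmonic, Finset.mul_sum _ _ (2 : ℚ), ← Finset.sum_add_distrib, Finset.mul_sum,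
      Finset.mul_sum,
      ← Finset.sum_sub_distrib, ← Finset.sum_add_distrib, ← Finset.sum_sub_distrib]
    exact Finset.sum_congr rfl fun k _ => by ring
  rw [e]
  push_cast
  ring

end powerSums

/-! ### The Bernoulli number `B_{p-5}` -/

section bernoulliNumber

variable {p : ℕ} [Fact p.Prime]

/-- Summation by parts for the harmonic numbers against `e`-th powers. -/
theorem sum_powHarmonic_one_mul_pow (e M : ℕ) :
    ∑ k ∈ Finset.range M, powHarmonic 1 (k + 1) * ((k : ℚ) + 1) ^ e =
      powHarmonic 1 M * ∑ k ∈ Finset.range (M + 1), (k : ℚ) ^ e -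
        ∑ j ∈ Finset.range M, (∑ k ∈ Finset.range (j + 1), (k : ℚ) ^ e) / ((j : ℚ) + 1) := by
  induction M with
  | zero => simp
  | succ M ih =>
    rw [Finset.sum_range_succ, ih, Finset.sum_range_succ _ (M + 1), powHarmonic_succ,
      Finset.sum_range_succ (fun j : ℕ => (∑ k ∈ Finset.range (j + 1), (k : ℚ) ^ e) / ((j : ℚ) + 1))]
    push_cast
    ring

/-- After summation by parts and Faulhaber's formula, the sum over `j` of `j^(e-i)` survives modulo `p`
only for `i = e`, where it equals `p - 1 ≡ -1`. -/
theorem sum_powHarmonic_one_mul_pow_sub_bernoulli_mem (h5 : 5 < p) {e : ℕ} (he : e + 2 < p) :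
    ∑ k ∈ Finset.range (p - 1), powHarmonic 1 (k + 1) * ((k : ℚ) + 1) ^ e - bernoulli e ∈
      padicBall p 1 := by
  have hB : ∀ i ≤ e, bernoulli i * ((e + 1).choose i : ℚ) / ((e : ℚ) + 1) ∈ padicBall p 0 := by
    intro i hi
    have h := div_natCast_mem_padicBall (mul_mem_padicBall
      (bernoulli_mem_padicBall (p := p) (i := i) (by omega))
      (natCast_mem_padicBall ((e + 1).choose i)) (t := 0) (by simp)) (m := e + 1) (by omega)
      (by omega)
    push_cast at h
    exact h
  have hinner : ∀ j : ℕ, (∑ k ∈ Finset.range (j + 1), (k : ℚ) ^ e) / ((j : ℚ) + 1) =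
      ∑ i ∈ Finset.range e, bernoulli i * ((e + 1).choose i : ℚ) / ((e : ℚ) + 1) *
        ((j : ℚ) + 1) ^ (e - i) + bernoulli e := by
    intro j
    have hj : (j : ℚ) + 1 ≠ 0 := by positivity
    have he' : (e : ℚ) + 1 ≠ 0 := by positivity
    rw [sum_range_pow, Finset.sum_range_succ, add_div, Finset.sum_div]
    congr 1
    · refine Finset.sum_congr rfl fun i hi => ?_
      have hi := Finset.mem_range.1 hi
      rw [show e + 1 - i = e - i + 1 by omega, pow_succ]
      push_cast
      field_simp
    · rw [Nat.choose_succ_self_right, Nat.add_sub_cancel_left]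
      push_cast
      field_simp
  have houter : ∑ j ∈ Finset.range (p - 1),
      (∑ k ∈ Finset.range (j + 1), (k : ℚ) ^ e) / ((j : ℚ) + 1) + bernoulli e ∈
      padicBall p 1 := by
    simp only [hinner]
    rw [Finset.sum_add_distrib, Finset.sum_comm, Finset.sum_const, Finset.card_range,
      nsmul_eq_mul, Nat.cast_sub (by omega : 1 ≤ p)]
    have h1 : ∑ i ∈ Finset.range e, ∑ j ∈ Finset.range (p - 1),
        bernoulli i * ((e + 1).choose i : ℚ) / ((e : ℚ) + 1) * ((j : ℚ) + 1) ^ (e - i) ∈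
        padicBall p 1 := by
      refine AddSubgroup.sum_mem _ fun i hi => ?_
      have hi := Finset.mem_range.1 hi
      rw [← Finset.mul_sum]
      exact mul_mem_padicBall (hB i hi.le)
        (sum_range_pow_mem_padicBall (by omega) (by omega)) (by simp)
    have h2 := mul_mem_padicBall prime_mem_padicBall
      (bernoulli_mem_padicBall (p := p) (i := e) (by omega)) (t := 1) (by simp)
    convert AddSubgroup.add_mem _ h1 h2 using 1
    push_cast
    ring
  have hS : ∑ k ∈ Finset.range (p - 1 + 1), (k : ℚ) ^ e ∈ padicBall p 0 :=
    AddSubgroup.sum_mem _ fun k _ => pow_mem_padicBall (natCast_mem_padicBall k) e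
  have hHS := mul_mem_padicBall (powHarmonic_one_pred_mem h5) hS (t := 1) (by simp)
  rw [sum_powHarmonic_one_mul_pow]
  convert AddSubgroup.sub_mem _ hHS houter using 1
  ring

/-- The congruence `H^{(4)}_{p-1} ≡ (4/5) p B_{p-5} (mod p²)`. -/
theorem powHarmonic_four_sub_bernoulli_mem (h5 : 5 < p) :
    powHarmonic 4 (p - 1) - 4 / 5 * p * bernoulli (p - 5) ∈ padicBall p 2 := by
  have h := binomTransform_pred_mem_padicBall_two (p := p) (by omega)
    (fun k => 1 / ((k : ℚ) + 1) ^ 4) fun k hk => one_div_succ_pow_mem_padicBall (by omega) 4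
  have e := binomTransform_one_div_pow 4 (p - 1 - 1)
  rw [show p - 1 - 1 + 1 = p - 1 by omega] at e
  rw [e, starHarmonic_four] at h
  rw [show ∑ k ∈ Finset.range (p - 1), 1 / ((k : ℚ) + 1) ^ 4 = powHarmonic 4 (p - 1) from rfl] at h
  have hB : ∑ k ∈ Finset.range (p - 1), powHarmonic 1 (k + 1) * (1 / ((k : ℚ) + 1) ^ 4) -
      bernoulli (p - 5) ∈ padicBall p 1 := by
    have h1 := sum_powHarmonic_one_mul_pow_sub_bernoulli_mem h5 (e := p - 5) (by omega)
    have h2 : ∑ k ∈ Finset.range (p - 1), powHarmonic 1 (k + 1) *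
        (1 / ((k : ℚ) + 1) ^ 4 - ((k : ℚ) + 1) ^ (p - 1 - 4)) ∈ padicBall p 1 :=
      AddSubgroup.sum_mem _ fun k hk => by
        have hk := Finset.mem_range.1 hk
        exact mul_mem_padicBall (powHarmonic_mem_padicBall (by omega) 1)
          (one_div_pow_sub_pow_mem_padicBall (by omega) (by omega)) (by simp)
    rw [show p - 1 - 4 = p - 5 by omega] at h2
    simp only [mul_sub, Finset.sum_sub_distrib] at h2
    convert AddSubgroup.add_mem _ h1 h2 using 1
    ring
  have hH1 := powHarmonic_one_pred_mem h5
  have hH2 := powHarmonic_pred_mem_padicBall_one (p := p) (s := 2) (by norm_num) (by omega)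
  have hH3 := powHarmonic_mem_padicBall (p := p) (n := p - 1) (by omega) 3
  have hH4 := powHarmonic_mem_padicBall (p := p) (n := p - 1) (by omega) 4
  have hpB := mul_mem_padicBall prime_mem_padicBall hB (t := 2) (by norm_num)
  have q0 := padicBall_anti (by norm_num : (0 : ℤ) ≤ 2) hH1
  generalize powHarmonic 1 (p - 1) = A at *
  generalize powHarmonic 2 (p - 1) = B at *
  generalize powHarmonic 3 (p - 1) = C at *
  generalize powHarmonic 4 (p - 1) = D at *
  have t1 := mul_mem_padicBall hH1 (pow_mem_padicBall q0 3) (t := 2) (by simp)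
  have t2 := mul_mem_padicBall hH1 (mul_mem_padicBall q0 hH2 (t := 0) (by simp)) (t := 2) (by simp)
  have t3 := mul_mem_padicBall hH2 hH2 (t := 2) (by simp)
  have t4 := mul_mem_padicBall hH1 hH3 (t := 2) (by simp)
  have t5 := AddSubgroup.add_mem _ (AddSubgroup.add_mem _ (AddSubgroup.add_mem _ t1
    (natCast_mul_mem_padicBall 6 t2)) (natCast_mul_mem_padicBall 3 t3))
    (natCast_mul_mem_padicBall 8 t4)
  have t6 := div_natCast_mem_padicBall (div_natCast_mem_padicBall (div_natCast_mem_padicBall t5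
    (m := 2) (by norm_num) (by omega)) (m := 3) (by norm_num) (by omega)) (m := 4) (by norm_num)
    (by omega)
  have t7 := natCast_mul_mem_padicBall 4 (AddSubgroup.add_mem _ (AddSubgroup.sub_mem _ h t6) hpB)
  have t8 := div_natCast_mem_padicBall t7 (m := 5) (by norm_num) (by omega)
  convert t8 using 1
  push_cast
  ring

end bernoulliNumber

/-! ### The supercongruence -/

section main

variable {p : ℕ} [Fact p.Prime]

/-- Pairing the expansions of `∏ (1 + p/m) = C(2p-1, p-1)` and `∏ (1 - p/m) = 1` gives
`C(2p-1, p-1) = ∏ (1 - p²/m²)`, in which only even power sums occur. -/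
theorem prod_one_sub_sq_mul_invBinom (h5 : 5 < p) :
    (∏ m ∈ Finset.range (p - 1), (1 + (-(p : ℚ) ^ 2) * (1 / ((m : ℚ) + 1) ^ 2))) *
      invBinom p (p - 1) = 1 := by
  have h1 := prod_one_add_mul_invBinom p (p - 1)
  have h2 := neg_one_pow_mul_choose (le_refl (p - 1))
  have e3 : ((p - 1 : ℕ) : ℚ) + 1 = p := by
    exact_mod_cast congrArg (Nat.cast : ℕ → ℚ) (show p - 1 + 1 = p by omega)
  have hodd : Even (p - 1) := (Fact.out : p.Prime).even_sub_one (by omega)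
  rw [hodd.neg_one_pow, Nat.choose_self, Nat.cast_one, mul_one, e3] at h2
  have h3 : ∏ m ∈ Finset.range (p - 1), (1 + (-(p : ℚ) ^ 2) * (1 / ((m : ℚ) + 1) ^ 2)) =
      (∏ m ∈ Finset.range (p - 1), (1 + (p : ℚ) * (1 / ((m : ℚ) + 1)))) *
        ∏ m ∈ Finset.range (p - 1), (1 + (-(p : ℚ)) * (1 / ((m : ℚ) + 1))) := by
    rw [← Finset.prod_mul_distrib]
    refine Finset.prod_congr rfl fun m _ => ?_
    have : (m : ℚ) + 1 ≠ 0 := by positivity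
    field_simp
    ring
  rw [h3, ← h2, mul_one, h1]

/-- The expansion `1 / C(2p-1, p-1) ≡ 1 - 2 p H_{p-1} + p⁴ H^{(4)}_{p-1} (mod p⁶)`. -/
theorem invBinom_pred_sub_mem (h5 : 5 < p) :
    invBinom p (p - 1) - (1 - 2 * p * powHarmonic 1 (p - 1) + p ^ 4 * powHarmonic 4 (p - 1)) ∈
      padicBall p 6 := by
  have h := prod_one_add_mul_sub_mem_padicBall (p := p) (by omega) (s := 2) (x := -(p : ℚ) ^ 2)
    (AddSubgroup.neg_mem _ (prime_pow_mem_padicBall 2))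
    (fun m => 1 / ((m : ℚ) + 1) ^ 2) (p - 1) fun m hm =>
      one_div_succ_pow_mem_padicBall (p := p) (k := m) (by omega) 2
  have hprod := prod_one_sub_sq_mul_invBinom h5
  have hv := invBinom_mem_padicBall (p := p) (k := p - 1) (by omega)
  have e1 : ∑ m ∈ Finset.range (p - 1), 1 / ((m : ℚ) + 1) ^ 2 = powHarmonic 2 (p - 1) := rfl
  have e2 : ∑ m ∈ Finset.range (p - 1), (1 / ((m : ℚ) + 1) ^ 2) ^ 2 = powHarmonic 4 (p - 1) := by
    rw [powHarmonic]
    exact Finset.sum_congr rfl fun m _ => by rw [div_pow, one_pow, ← pow_mul]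
  simp only [e1, e2] at h
  have hH2 := powHarmonic_pred_mem_padicBall_one (p := p) (s := 2) (by norm_num) (by omega)
  have hH4 := powHarmonic_pred_mem_padicBall_one (p := p) (s := 4) (by norm_num) (by omega)
  -- the weight `5` needs `6 < p`
  have h6 : p ≠ 6 := by
    rintro rfl
    exact absurd (Fact.out : Nat.Prime 6) (by norm_num)
  have hH5 := powHarmonic_pred_mem_padicBall_one (p := p) (s := 5) (by norm_num) (by omega)
  have r1 := two_mul_powHarmonic_one_mem (p := p)
  have r3 := two_mul_powHarmonic_three_mem (p := p)
  generalize ∏ m ∈ Finset.range (p - 1), (1 + (-(p : ℚ) ^ 2) * (1 / ((m : ℚ) + 1) ^ 2)) = P at *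
  generalize powHarmonic 1 (p - 1) = A at *
  generalize powHarmonic 2 (p - 1) = B at *
  generalize powHarmonic 3 (p - 1) = C at *
  generalize powHarmonic 4 (p - 1) = D at *
  generalize powHarmonic 5 (p - 1) = E at *
  generalize invBinom p (p - 1) = v at *
  have hD2 := div_natCast_mem_padicBall hH4 (m := 2) (by norm_num) (by omega)
  have ha : (p : ℚ) ^ 2 * B + (p : ℚ) ^ 4 * (D / (2 : ℕ)) ∈ padicBall p 3 :=
    AddSubgroup.add_mem _ (prime_pow_mul_mem_padicBall 2 hH2 (by simp))
      (prime_pow_mul_mem_padicBall 4 hD2 (by simp))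
  have ha1 := AddSubgroup.add_mem _ (one_mem_padicBall (p := p))
    (padicBall_anti (by norm_num : (0 : ℤ) ≤ 3) ha)
  have hBB := div_natCast_mem_padicBall (mul_mem_padicBall hH2 hH2 (t := 2) (by norm_num)) (m := 2)
    (by norm_num) (by omega)
  have t1 := AddSubgroup.add_mem _ (padicBall_anti (by norm_num : (6 : ℤ) ≤ 3 * (2 : ℕ)) h)
    (prime_pow_mul_mem_padicBall 4 hBB (t := 6) (by simp))
  have t2 := mul_mem_padicBall t1 ha1 (t := 6) (by simp)
  have t3 := mul_mem_padicBall ha ha (t := 6) (by simp)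
  have t4 := mul_mem_padicBall hv (AddSubgroup.sub_mem _ t3 t2) (t := 6) (by simp)
  have t5 := mul_mem_padicBall prime_mem_padicBall r1 (t := 6) (by norm_num)
  have t6 := div_natCast_mem_padicBall (prime_pow_mul_mem_padicBall 3 r3 (t := 6) (by simp))
    (m := 2) (by norm_num) (by omega)
  have t7 := natCast_mul_mem_padicBall 2 (prime_pow_mul_mem_padicBall 5 hH5 (t := 6) (by simp))
  convert AddSubgroup.add_mem _ (AddSubgroup.sub_mem _ (AddSubgroup.add_mem _ t4 t5) t6) t7 using 1
  push_cast
  linear_combination ((1 + (p : ℚ) ^ 2 * B + (p : ℚ) ^ 4 * (D / 2))) * hprod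

/-- The congruence `H^{(2)}_{p-1} / 2 ≡ - H_{p-1} / p (mod p³)`. -/
theorem half_powHarmonic_two_add_mem (h5 : 5 < p) :
    powHarmonic 2 (p - 1) / 2 + powHarmonic 1 (p - 1) / p ∈ padicBall p 3 := by
  have hp : (p : ℚ) ≠ 0 := by exact_mod_cast (Fact.out : p.Prime).ne_zero
  have hH3 := powHarmonic_three_pred_mem h5
  have hH4 := powHarmonic_pred_mem_padicBall_one (p := p) (s := 4) (by norm_num) (by omega)
  have hH5 := powHarmonic_mem_padicBall (p := p) (n := p - 1) (by omega) 5
  have t1 := div_prime_pow_mem_padicBall two_mul_powHarmonic_one_mem 1 (p := p) (t := 3)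
    (by norm_num)
  have t2 := prime_pow_mul_mem_padicBall 1 hH3 (t := 3) (by simp)
  have t3 := prime_pow_mul_mem_padicBall 2 hH4 (t := 3) (by simp)
  have t4 := prime_pow_mul_mem_padicBall 3 hH5 (t := 3) (by simp)
  have t5 := div_natCast_mem_padicBall (AddSubgroup.sub_mem _ (AddSubgroup.sub_mem _
    (AddSubgroup.sub_mem _ t1 t2) t3) t4) (m := 2) (by norm_num) (by omega)
  convert t5 using 1
  push_cast
  field_simp
  ring

theorem zeilberger_sum_sub_mem (h5 : 5 < p) :
    ∑ k ∈ Finset.range (p - 1),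
        (21 * ((k : ℚ) + 1) - 8) * invBinom (k + 1) (k + 1) ^ 3 / ((k : ℚ) + 1) ^ 3 +
      ((p : ℚ) - 1) / (p : ℚ) ^ 3 -
      (powHarmonic 1 (p - 1) / (p : ℚ) ^ 2 * (15 * (p : ℚ) - 6) +
        12 / 5 * (p : ℚ) ^ 2 * bernoulli (p - 5)) ∈ padicBall p 3 := by
  have hp : (p : ℚ) ≠ 0 := by exact_mod_cast (Fact.out : p.Prime).ne_zero
  have e3 : ((p - 1 : ℕ) : ℚ) + 1 = p := by
    exact_mod_cast congrArg (Nat.cast : ℕ → ℚ) (show p - 1 + 1 = p by omega)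
  rw [zeilberger_sum_eq_invBinom, e3, show p - 1 + 1 = p by omega]
  have hV := sum_invBinom_div_sq_add_mem h5
  have hU := sum_invBinom_sq_div_sq_add_mem h5
  have hv := invBinom_pred_sub_mem h5
  have hBern := powHarmonic_four_sub_bernoulli_mem h5
  have hH1 := powHarmonic_one_pred_mem h5
  have hH2 := powHarmonic_mem_padicBall (p := p) (n := p - 1) (by omega) 2
  have hH4 := powHarmonic_pred_mem_padicBall_one (p := p) (s := 4) (by norm_num) (by omega)
  have h21 := half_powHarmonic_two_add_mem h5
  generalize ∑ k ∈ Finset.range (p - 1), invBinom p (k + 1) ^ 2 / ((k : ℚ) + 1) ^ 2 = U at *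
  generalize ∑ k ∈ Finset.range (p - 1), invBinom p (k + 1) / ((k : ℚ) + 1) ^ 2 = V at *
  generalize powHarmonic 1 (p - 1) = A at *
  generalize powHarmonic 2 (p - 1) = B at *
  generalize powHarmonic 4 (p - 1) = D at *
  generalize bernoulli (p - 5) = b at *
  obtain ⟨ε, hε⟩ : ∃ ε, ε = invBinom p (p - 1) - (1 - 2 * p * A + p ^ 4 * D) := ⟨_, rfl⟩
  rw [← hε] at hv
  have hv' : invBinom p (p - 1) = 1 + (p ^ 4 * D - (2 : ℕ) * (p * A)) + ε := by
    push_cast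
    linarith
  rw [hv']
  have ha : (p : ℚ) ^ 4 * D - (2 : ℕ) * (p * A) ∈ padicBall p 3 :=
    AddSubgroup.sub_mem _ (prime_pow_mul_mem_padicBall 4 hH4 (by simp))
      (natCast_mul_mem_padicBall 2 (mul_mem_padicBall prime_mem_padicBall hH1 (by norm_num)))
  have hδ : (p : ℚ) ^ 4 * D - (2 : ℕ) * (p * A) + ε ∈ padicBall p 3 :=
    AddSubgroup.add_mem _ ha (padicBall_anti (by norm_num) hv)
  have hδ0 := padicBall_anti (by norm_num : (0 : ℤ) ≤ 3) hδ
  have hU0 : U ∈ padicBall p 0 := by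
    have := AddSubgroup.sub_mem _ (padicBall_anti (by norm_num : (0 : ℤ) ≤ 3) hU)
      (natCast_mul_mem_padicBall 2 hH2)
    convert this using 1
    push_cast
    ring
  -- `v ^ 3 ≡ 1 + 3 (v - 1)` modulo `p ^ 6`, as `v - 1` is divisible by `p ^ 3`
  have hcube := mul_mem_padicBall (mul_mem_padicBall hδ hδ (t := 6) (by norm_num))
    (AddSubgroup.add_mem _ (natCast_mem_padicBall (p := p) 3) hδ0) (t := 6) (by simp)
  have hε3 := AddSubgroup.add_mem _ (natCast_mul_mem_padicBall 3 hv) hcube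
  have s1 := div_prime_pow_mem_padicBall hv 2 (t := 3) (by norm_num)
  have s2 := div_natCast_mem_padicBall s1 (m := 2) (by norm_num) (by omega)
  have s3 := div_prime_pow_mem_padicBall hε3 3 (t := 3) (by norm_num)
  have s4 := natCast_mul_mem_padicBall 5 (div_natCast_mem_padicBall
    (div_prime_pow_mem_padicBall hε3 2 (t := 3) (by norm_num)) (m := 2) (by norm_num) (by omega))
  have s5 := div_natCast_mem_padicBall (mul_mem_padicBall hδ hU0 (t := 3) (by simp)) (m := 2)
    (by norm_num) (by omega)
  have s6 := div_natCast_mem_padicBall hU (m := 2) (by norm_num) (by omega)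
  have s7 := natCast_mul_mem_padicBall 3 (mul_mem_padicBall prime_mem_padicBall hBern (t := 3)
    (by norm_num))
  have s8 := natCast_mul_mem_padicBall 7 (prime_pow_mul_mem_padicBall 2 hH4 (t := 3) (by simp))
  have key := AddSubgroup.sub_mem _ (AddSubgroup.add_mem _ (AddSubgroup.sub_mem _
    (AddSubgroup.add_mem _ (AddSubgroup.add_mem _ (AddSubgroup.add_mem _ (AddSubgroup.sub_mem _
    (AddSubgroup.add_mem _ s2 s3) s4) s5) s6) hV) h21) s7) s8
  convert key using 1
  push_cast
  field_simp
  ring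

end main

theorem one_div_choose_two_mul_eq (k : ℕ) :
    1 / ((2 * k).choose k : ℚ) = invBinom k k := by
  rw [invBinom, two_mul]

theorem theorem5 (p : ℕ) (hp : p.Prime) (h5 : 5 < p) :
    RatModEq (p ^ 3)
      ((∑ k ∈ Finset.Icc 1 (p - 1),
          (21 * (k : ℚ) - 8) / ((k : ℚ) ^ 3 * (Nat.choose (2 * k) k : ℚ) ^ 3))
        + ((p : ℚ) - 1) / (p : ℚ) ^ 3)
      (harmonic (p - 1) / (p : ℚ) ^ 2 * (15 * (p : ℚ) - 6)
        + 12 / 5 * (p : ℚ) ^ 2 * bernoulli (p - 5)) := by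
  have : Fact p.Prime := ⟨hp⟩
  have hH : harmonic (p - 1) = powHarmonic 1 (p - 1) := by
    simp [harmonic, powHarmonic]
  have hS : ∑ k ∈ Finset.Icc 1 (p - 1),
      (21 * (k : ℚ) - 8) / ((k : ℚ) ^ 3 * (Nat.choose (2 * k) k : ℚ) ^ 3) =
      ∑ k ∈ Finset.range (p - 1),
        (21 * ((k : ℚ) + 1) - 8) * invBinom (k + 1) (k + 1) ^ 3 / ((k : ℚ) + 1) ^ 3 := by
    rw [← Finset.Ico_add_one_right_eq_Icc, Finset.sum_Ico_eq_sum_range, Nat.add_sub_cancel]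
    refine Finset.sum_congr rfl fun k _ => ?_
    rw [add_comm 1 k, ← one_div_choose_two_mul_eq]
    push_cast
    rw [one_div_pow, mul_one_div, div_div, mul_comm (_ ^ 3)]
  rw [hH, hS]
  exact ratModEq_of_mem_padicBall (r := 3) (by exact_mod_cast zeilberger_sum_sub_mem h5)
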